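/- Let $\mathfrak g$ be a finite-dimensional simple real Lie algebra with the metric $\langle x,y\rangle=\mathrm{tr}_R(xy)$ of a finite-dimensional representation $R$, assumed nondegenerate. Let $t^-,t^0,t^+$ span an $s\ell(2,\mathbb R)$ subalgebra, with $[t^0,t^\pm]=\pm t^\pm$ and $[t^+,t^-]=2t^0$, whose grading $\mathfrak g=\mathfrak g_-\oplus\mathfrak g_0\oplus\mathfrak g_+$ by the eigenvalues of $\mathrm{ad}\,t^0$ is integral, and assume that $\mathfrak g_+$ (equivalently the group $G_+=\exp\mathfrak g_+$) is Abelian. Let $t^a$ be a homogeneous basis of $\mathfrak g$, and let $J_a$ be the coordinates of the generic element $J_{tot}=J_at^a$, with Poisson bracket $\{J_a,J_b\}=f_{ab}{}^cJ_c$, where $f_{ab}{}^c$ are the structure constants with indices moved by $\eta^{ab}=\langle t^a,t^b\rangle$. Indices $\alpha$ refer to negative degree. *The finite W-algebra of $G_+$.* It is the algebra $\mathcal W$ of polynomials in the $J_a$ of degree $\ge 0$ that are invariant under the gauge transformations $J\mapsto g^{-1}Jg$, $g\in G_+$, of the constraint surface $J_\alpha t^\alpha=t^-$; its bracket is the Poisson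 bracket followed by restriction to that surface. Fix a basis $\ell^s$ of $\ker\mathrm{ad}\,t^+$ with $[t^0,\ell^s]=\sigma(s)\ell^s$. *The enlarged W-algebra.* Let $O\subset\mathfrak g_-$ be the set of $\psi(t^-)\in\mathfrak g_-$, where $\psi$ runs over the automorphisms of $\mathfrak g$ that fix $t^0$ and preserve the metric (it contains the orbit of $t^-$ under $G_0$). Let $V\subset O$ be open. For $\tilde t^-=J_\alpha t^\alpha\in V$ let $\tilde t^+$ complete $\tilde t^-,t^0$ to an $s\ell(2,\mathbb R)$ triple, and let $\tilde\ell^s$ be any basis of $\ker\mathrm{ad}\,\tilde t^+$ with $[t^0,\tilde\ell^s]=\sigma(s)\tilde\ell^s$ that depends smoothly on the $J_\alpha$. The enlarged W-algebra is generated by the $J_\alpha$ and by the $\tilde W_s$ defined by $g^{-1}J_{tot}\,g=J_\alpha t^\alpha+\tilde W_s\tilde\ell^s$ with $g\in G_+$. **Claim.** Over $V$ the element $g$ and the $\tilde W_s$ exist and are unique. $\mathcal W$ is closed under its bracket, and is generated by the polynomials $W_s$ defined by $g^{-1}Jg=t^-+W_s\ell^s$, $g\in G_+$, on the constraint surface.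 Moreover: 1. For every $c_0\in V$ there are an open set $U\subset V$ that contains $c_0$ and is dense in $V$, and smooth functions $F_{sr}$ on $U$ with $(F_{sr}(c))$ invertible for each $c\in U$ and $F_{sr}=0$ unless $\sigma(s)=\sigma(r)$, such that the renormalized generators $\hat W_s=\sum_rF_{sr}(J_\alpha)\tilde W_r$ form the finite W-algebra of $G_+$: they are smooth on $\{J_\alpha t^\alpha\in U\}$, they Poisson commute with all $J_\alpha$, and $W_s\mapsto\hat W_s$ extends to an injective homomorphism of Poisson algebras from $\mathcal W$ to the functions on $\{J_\alpha t^\alpha\in U\}$. 2. Suppose that $V\neq\emptyset$ and that the $\tilde\ell^s$ are proportional to conjugates of the $\ell^s$: there are nowhere zero smooth functions $m_s$ on $V$ such that for each $c\in V$ some automorphism $\psi$ of $\mathfrak g$ that fixes $t^0$ and preserves the metric satisfies $\psi(t^-)=c$ and $\psi(\ell^s)=m_s(c)\,\tilde\ell^s(c)$ for all $s$. Then the rescaled generators $\hat W_s=m_s(J_\alpha)^{-1}\,\tilde W_s$ form the finite W-algebra of $G_+$ over all of $V$, in the same sense. -/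

import Mathlib

open scoped ContDiff

noncomputable section

namespace FiniteW

variable {g : Type*} [LieRing g] [LieAlgebra ℝ g]
variable {ι : Type*} [Fintype ι] [DecidableEq ι]

/-- The metric `η^{ab} = ⟨t^a, t^b⟩` in the basis `t^a`. -/
def metric (B : LinearMap.BilinForm ℝ g) (t : Module.Basis ι ℝ g) : Matrix ι ι ℝ :=
  Matrix.of fun a d => B (t a) (t d)

/-- The lowered structure constants
`f_{ab}^c = η_{ad} η_{be} η^{ck} f^{de}_k`, where `[t^d, t^e] = f^{de}_k t^k` and
`η_{ab}` is the inverse matrix of `η^{ab}`. -/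
def lowStruct (B : LinearMap.BilinForm ℝ g) (t : Module.Basis ι ℝ g) (a b c : ι) : ℝ :=
  ∑ d, ∑ e, ∑ k, (metric B t)⁻¹ a d * (metric B t)⁻¹ b e * metric B t c k *
    t.repr ⁅t d, t e⁆ k

/-- The Poisson bracket on functions of the coordinates `J_a`, determined by
`{J_a, J_b} = f_{ab}^c J_c`.  A point `x : ι → ℝ` stands for the values of the `J_a`. -/
def poisson (B : LinearMap.BilinForm ℝ g) (t : Module.Basis ι ℝ g)
    (F H : (ι → ℝ) → ℝ) (x : ι → ℝ) : ℝ :=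
  ∑ a, ∑ b, fderiv ℝ F x (Pi.single a 1) * fderiv ℝ H x (Pi.single b 1) *
    ∑ c, lowStruct B t a b c * x c

/-- The same Poisson bracket on polynomials in the `J_a`. -/
def polyPoisson (B : LinearMap.BilinForm ℝ g) (t : Module.Basis ι ℝ g)
    (P Q : MvPolynomial ι ℝ) : MvPolynomial ι ℝ :=
  ∑ a, ∑ b, MvPolynomial.pderiv a P * MvPolynomial.pderiv b Q *
    ∑ c, MvPolynomial.C (lowStruct B t a b c) * MvPolynomial.X c

/-- The indices `α ∈ I_-` of negative degree. -/
abbrev NegIdx (deg : ι → ℤ) : Type _ := {a : ι // deg a < 0}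

/-- The indices of degree zero or positive degree. -/
abbrev NonnegIdx (deg : ι → ℤ) : Type _ := {a : ι // 0 ≤ deg a}

/-- The matrix `J_tot = J_a t^a` at the point `x`. -/
def total (t : Module.Basis ι ℝ g) (x : ι → ℝ) : g := ∑ a, x a • t a

/-- The values of the `J_α`, `α ∈ I_-`, at the point `x`. -/
def negCoord (deg : ι → ℤ) (x : ι → ℝ) : NegIdx deg → ℝ := fun α => x α

/-- The element `J_α t^α` of `g_-`. -/
def negElt (t : Module.Basis ι ℝ g) (deg : ι → ℤ) (c : NegIdx deg → ℝ) : g :=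
  ∑ α : NegIdx deg, c α • t α

/-- The positive part `g_+` of the gradation. -/
def gPlus (t : Module.Basis ι ℝ g) (deg : ι → ℤ) : Submodule ℝ g :=
  Submodule.span ℝ (t '' {a | 0 < deg a})

/-- The adjoint action `exp (ad y)` of the group element `exp y`, for `ad y` nilpotent. -/
def expAd (y x : g) : g :=
  ∑ n ∈ Finset.range (nilpotencyClass (LieAlgebra.ad ℝ g y)),
    (n.factorial : ℝ)⁻¹ • ((LieAlgebra.ad ℝ g y) ^ n) x

/-- `ℓ` is a basis of the highest weight vectors `ker (ad e)`, with
`[t⁰, ℓ^s] = σ(s) ℓ^s` where `t⁰ = h / 2`. -/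
structure IsHighestWeightBasis {κ : Type*} (h e : g) (σ : κ → ℤ) (ℓ : κ → g) : Prop where
  linearIndependent : LinearIndependent ℝ ℓ
  span_eq : Submodule.span ℝ (Set.range ℓ) = LinearMap.ker (LieAlgebra.ad ℝ g e : g →ₗ[ℝ] g)
  weight : ∀ s, ⁅h, ℓ s⁆ = (2 * (σ s : ℝ)) • ℓ s

/-! ### The constrained algebra -/

/-- The point of the constraint surface `J_α = χ_α` with given values of the remaining `J_a`;
the `χ_α` are the coordinates of `f = t^-`. -/
def constrPt (t : Module.Basis ι ℝ g) (deg : ι → ℤ) (f : g) (u : NonnegIdx deg → ℝ) : ι → ℝ :=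
  fun a => if ha : 0 ≤ deg a then u ⟨a, ha⟩ else t.repr f a

/-- Imposing the constraints `J_α = χ_α` on a polynomial in the `J_a`. -/
def imposeConstr (t : Module.Basis ι ℝ g) (deg : ι → ℤ) (f : g) :
    MvPolynomial ι ℝ →ₐ[ℝ] MvPolynomial (NonnegIdx deg) ℝ :=
  MvPolynomial.aeval fun a =>
    if ha : 0 ≤ deg a then MvPolynomial.X ⟨a, ha⟩ else MvPolynomial.C (t.repr f a)

/-- The bracket `{p, q}_Const`: the constraints are imposed after the bracket is computed. -/
def constrBracket (B : LinearMap.BilinForm ℝ g) (t : Module.Basis ι ℝ g) (deg : ι → ℤ) (f : g)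
    (p q : MvPolynomial (NonnegIdx deg) ℝ) : MvPolynomial (NonnegIdx deg) ℝ :=
  imposeConstr t deg f
    (polyPoisson B t (MvPolynomial.rename Subtype.val p) (MvPolynomial.rename Subtype.val q))

/-- The finite W-algebra of the gauge group `G_+`: the polynomials in the `J_i` and `J_ᾱ` that
are invariant under the gauge transformations of the constraint surface (its Poisson bracket is
`constrBracket`). -/
def wAlgebra (t : Module.Basis ι ℝ g) (deg : ι → ℤ) (f : g) :
    Subalgebra ℝ (MvPolynomial (NonnegIdx deg) ℝ) where
  carrier := {p | ∀ y ∈ gPlus t deg, ∀ u u' : NonnegIdx deg → ℝ,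
    total t (constrPt t deg f u') = expAd y (total t (constrPt t deg f u)) →
      MvPolynomial.eval u' p = MvPolynomial.eval u p}
  mul_mem' := by
    intro p q hp hq y hy u u' h
    simp only [map_mul, hp y hy u u' h, hq y hy u u' h]
  add_mem' := by
    intro p q hp hq y hy u u' h
    simp only [map_add, hp y hy u u' h, hq y hy u u' h]
  algebraMap_mem' := by
    intro r y hy u u' h
    simp [MvPolynomial.algebraMap_eq]

/-- `W` are the generators of the finite W-algebra read off from the highest weight gauge
`J^g = t^- + W_s ℓ^s` with `g ∈ G_+`. -/
def IsGaugeGenerators {κ : Type*} [Fintype κ] (t : Module.Basis ι ℝ g) (deg : ι → ℤ) (f : g)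
    (ℓ : κ → g) (W : κ → wAlgebra t deg f) : Prop :=
  ∀ u : NonnegIdx deg → ℝ, ∃ y ∈ gPlus t deg,
    expAd y (total t (constrPt t deg f u)) =
      f + ∑ s, MvPolynomial.eval u (W s : MvPolynomial (NonnegIdx deg) ℝ) • ℓ s

/-! ### The enlarged algebra -/

/-- The element `exp y ∈ G_+` brings `J_tot` at the point `x` to the highest weight form
`J_α t^α + w_s ℓ^s`; the vectors `ℓ^s` depend on the `J_α`. -/
def IsHighestWeightForm {κ : Type*} [Fintype κ] (t : Module.Basis ι ℝ g) (deg : ι → ℤ)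
    (ℓ : κ → (NegIdx deg → ℝ) → g) (x : ι → ℝ) (y : g) (w : κ → ℝ) : Prop :=
  expAd y (total t x) = negElt t deg (negCoord deg x) + ∑ s, w s • ℓ s (negCoord deg x)

open scoped Classical in
/-- The generators `W̃_s` of the enlarged W-algebra (zero where the highest weight form cannot
be reached). -/
def wTilde {κ : Type*} [Fintype κ] (t : Module.Basis ι ℝ g) (deg : ι → ℤ)
    (ℓ : κ → (NegIdx deg → ℝ) → g) (s : κ) (x : ι → ℝ) : ℝ :=
  if hx : ∃ w : κ → ℝ, ∃ y ∈ gPlus t deg, IsHighestWeightForm t deg ℓ x y w then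
    hx.choose s else 0

/-- `ψ` is an automorphism of `g` which fixes `t⁰ = h / 2`, preserves the metric, and sends
`t^- = f` to `J_α t^α` with `J_α = c_α`.  The elements of `G_0` which send `t^-` to `J_α t^α`
act in this way. -/
structure IsGradedConj (B : LinearMap.BilinForm ℝ g) (t : Module.Basis ι ℝ g) (deg : ι → ℤ)
    (h f : g) (c : NegIdx deg → ℝ) (ψ : g ≃ₗ⁅ℝ⁆ g) : Prop where
  map_h : ψ h = h
  map_form : ∀ x y, B (ψ x) (ψ y) = B x y
  map_f : ψ f = negElt t deg c

/-- The values of the `J_α` for which `t̃^- = J_α t^α` is conjugate to `t^- = f`; this contains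
the orbit of `t^-` under the group `G_0`. -/
def regularSet (B : LinearMap.BilinForm ℝ g) (t : Module.Basis ι ℝ g) (deg : ι → ℤ) (h f : g) :
    Set (NegIdx deg → ℝ) :=
  {c | ∃ ψ : g ≃ₗ⁅ℝ⁆ g, IsGradedConj B t deg h f c ψ}

/-- `ℓ` is a smooth choice, over the open set `V` of values of the `J_α`, of a basis of the
highest weight vectors of the triple `t̃^+, t⁰, t̃^-` with `t̃^- = J_α t^α`. -/
structure IsHighestWeightFrame {κ : Type*} (t : Module.Basis ι ℝ g) (deg : ι → ℤ)
    (h : g) (σ : κ → ℤ) (V : Set (NegIdx deg → ℝ)) (ℓ : κ → (NegIdx deg → ℝ) → g) : Prop where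
  smooth : ∀ s, ContDiffOn ℝ ∞ (fun c => t.equivFun (ℓ s c)) V
  basis : ∀ c ∈ V, ∃ e' : g, IsSl2Triple h e' (negElt t deg c) ∧
    IsHighestWeightBasis h e' σ (fun s => ℓ s c)

/-- The renormalized generators `Ŵ_s = ∑_r F_{sr}(J_α) W̃_r`. -/
def renormalized {κ : Type*} [Fintype κ] (t : Module.Basis ι ℝ g) (deg : ι → ℤ)
    (ℓ : κ → (NegIdx deg → ℝ) → g) (F : (NegIdx deg → ℝ) → Matrix κ κ ℝ) (s : κ)
    (x : ι → ℝ) : ℝ :=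
  ∑ r, F (negCoord deg x) s r * wTilde t deg ℓ r x

/-- Over the set `U` of values of the `J_α`, the functions `What s` form the finite W-algebra of
`G_+` with generators `W s`: they are smooth, they Poisson commute with the `J_α`, and
`W s ↦ What s` extends to an injective homomorphism of Poisson algebras. -/
structure FormWAlgebra {κ : Type*} (B : LinearMap.BilinForm ℝ g) (t : Module.Basis ι ℝ g)
    (deg : ι → ℤ) (f : g) (U : Set (NegIdx deg → ℝ)) (W : κ → wAlgebra t deg f)
    (What : κ → (ι → ℝ) → ℝ) : Prop where
  smooth : ∀ s, ContDiffOn ℝ ∞ (What s) {x | negCoord deg x ∈ U}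
  central : ∀ (α : NegIdx deg) (s : κ) (x : ι → ℝ), negCoord deg x ∈ U →
    poisson B t (fun z => z α) (What s) x = 0
  exists_hom : ∃ Φ : wAlgebra t deg f →ₐ[ℝ] ((ι → ℝ) → ℝ),
    (∀ s, Φ (W s) = What s) ∧
    (∀ p, (∀ x, negCoord deg x ∈ U → Φ p x = 0) → p = 0) ∧
    ∀ p q r : wAlgebra t deg f,
      (r : MvPolynomial (NonnegIdx deg) ℝ) = constrBracket B t deg f p q →
        ∀ x, negCoord deg x ∈ U → poisson B t (Φ p) (Φ q) x = Φ r x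

end FiniteW

end

/-!
If `x` has degree `k ≥ 2`, then `x` and `⁅t⁻, x⁆` have positive degree, so for abelian `g_+` they
commute with `t⁺` and `0 = ⁅t⁺, ⁅t⁻, x⁆⁆ = 2 k x`. The metric pairs the degrees `k` and `-k`, so the
grading is `g_{-1} ⊕ g_0 ⊕ g_1`, and `exp (ad y)` is quadratic in `y ∈ g_+`. In degree `0` the
highest weight condition then reads `⁅t⁺, J_0⁆ = ± 2 y`, which is solved by exactly one `y`, and
the `W_s` are polynomials.

An automorphism `ψ` that fixes `t⁰` and preserves the metric carries the gauge fixing over `t⁻` to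
the one over `c = ψ t⁻`. Hence `W_s (ψ⁻¹ J)`, with `ψ` depending on `c`, is a linear combination of
the enlarged generators with coefficients that are functions of `c`, and serves as `Ŵ_s`. Its
gradient differs from the one obtained by holding `ψ` constant only by an element of `g_+`, which
generates a gauge transformation and so does not contribute to brackets of gauge invariant
functions; this is why the `Ŵ_s` have the brackets of the `W_s`.

Exponentials of `ad z`, `z ∈ g_0`, provide a smooth local choice of `ψ`. A maximal family of
pairwise disjoint open sets with such choices is dense, so no compatibility between them is needed.
-/

namespace FiniteW

section Grading

variable {𝕜 g ι : Type*} [Field 𝕜] [LieRing g] [LieAlgebra 𝕜 g]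
  {B : LinearMap.BilinForm 𝕜 g} {t : Module.Basis ι 𝕜 g} {deg : ι → ℤ} {h e f x y : g}
  {i j k : ℤ}

variable (𝕜) in
/-- The vectors of degree `k`: since `t⁰ = h / 2`, they form the eigenspace of `ad h` for the
eigenvalue `2 k`. -/
def degSpace (h : g) (k : ℤ) : Submodule 𝕜 g :=
  Module.End.eigenspace (LieAlgebra.ad 𝕜 g h) (2 * (k : 𝕜))

lemma mem_degSpace : x ∈ degSpace 𝕜 h k ↔ ⁅h, x⁆ = (2 * (k : 𝕜)) • x :=
  Module.End.mem_eigenspace_iff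

lemma lie_mem_degSpace (hx : x ∈ degSpace 𝕜 h i) (hy : y ∈ degSpace 𝕜 h j) :
    ⁅x, y⁆ ∈ degSpace 𝕜 h (i + j) := by
  rw [mem_degSpace] at *
  rw [leibniz_lie, hx, hy, smul_lie, lie_smul, ← add_smul]
  push_cast
  ring_nf

lemma e_mem_degSpace (htriple : IsSl2Triple h e f) : e ∈ degSpace 𝕜 h 1 := by
  simp [mem_degSpace, htriple.lie_h_e_smul 𝕜]

lemma f_mem_degSpace (htriple : IsSl2Triple h e f) : f ∈ degSpace 𝕜 h (-1) := by
  simp [mem_degSpace, htriple.lie_lie_smul_f 𝕜]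

lemma form_eq_zero_of_mem_degSpace [CharZero 𝕜] (hB : B.lieInvariant g)
    (hx : x ∈ degSpace 𝕜 h i) (hy : y ∈ degSpace 𝕜 h j) (hij : i + j ≠ 0) : B x y = 0 := by
  have hinv := hB h x y
  rw [mem_degSpace.1 hx, mem_degSpace.1 hy, map_smul, map_smul, LinearMap.smul_apply,
    smul_eq_mul, smul_eq_mul] at hinv
  have hmul : (2 * ((i + j : ℤ) : 𝕜)) * B x y = 0 := by
    push_cast
    linear_combination hinv
  exact (mul_eq_zero.1 hmul).resolve_left
    (mul_ne_zero two_ne_zero (Int.cast_ne_zero.2 hij))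

lemma mem_degSpace_of_form (hB : B.lieInvariant g) (hnd : B.SeparatingLeft)
    (ht : ∀ a, t a ∈ degSpace 𝕜 h (deg a)) (hx : ∀ a, deg a ≠ -k → B x (t a) = 0) :
    x ∈ degSpace 𝕜 h k := by
  have hzero : B (⁅h, x⁆ - (2 * (k : 𝕜)) • x) = 0 := by
    refine t.ext fun a => ?_
    rw [map_sub, LinearMap.sub_apply, hB, mem_degSpace.1 (ht a), map_smul, map_smul,
      LinearMap.smul_apply, smul_eq_mul, smul_eq_mul, LinearMap.zero_apply]
    obtain ha | ha := eq_or_ne (deg a) (-k)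
    · rw [ha]
      push_cast
      ring
    · rw [hx a ha]
      ring
  rw [mem_degSpace, ← sub_eq_zero]
  exact hnd _ fun y => by rw [hzero, LinearMap.zero_apply]

lemma repr_eq_zero_of_mem_degSpace [CharZero 𝕜] (ht : ∀ a, t a ∈ degSpace 𝕜 h (deg a))
    (hx : x ∈ degSpace 𝕜 h k) {a : ι} (ha : deg a ≠ k) : t.repr x a = 0 := by
  have hcoord : t.coord a ∘ₗ (LieAlgebra.ad 𝕜 g h : g →ₗ[𝕜] g) =
      (2 * (deg a : 𝕜)) • t.coord a := by
    classical
    refine t.ext fun b => ?_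
    obtain rfl | hab := eq_or_ne b a
    · simp [mem_degSpace.1 (ht b)]
    · simp [mem_degSpace.1 (ht b), hab]
  have heq := LinearMap.congr_fun hcoord x
  simp only [LinearMap.comp_apply, LieAlgebra.ad_apply, mem_degSpace.1 hx, map_smul,
    LinearMap.smul_apply, Module.Basis.coord_apply, smul_eq_mul] at heq
  have hmul : (2 * ((k - deg a : ℤ) : 𝕜)) * t.repr x a = 0 := by
    push_cast
    linear_combination heq
  exact (mul_eq_zero.1 hmul).resolve_left
    (mul_ne_zero two_ne_zero (Int.cast_ne_zero.2 (sub_ne_zero.2 ha.symm)))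

lemma degSpace_eq_span [CharZero 𝕜] (ht : ∀ a, t a ∈ degSpace 𝕜 h (deg a)) (k : ℤ) :
    degSpace 𝕜 h k = Submodule.span 𝕜 (t '' {a | deg a = k}) := by
  refine le_antisymm (fun x hx => t.mem_span_image.2 fun a ha => ?_) ?_
  · by_contra hne
    exact Finsupp.mem_support_iff.1 ha (repr_eq_zero_of_mem_degSpace ht hx hne)
  · rw [Submodule.span_le]
    rintro _ ⟨a, rfl, rfl⟩
    exact ht a

/-- The projection to the component of degree `k` along the other vectors of the homogeneous
basis `t`. -/
noncomputable def component (t : Module.Basis ι 𝕜 g) (deg : ι → ℤ) (k : ℤ) : g →ₗ[𝕜] g :=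
  t.constr 𝕜 fun a => if deg a = k then t a else 0

lemma component_basis (k : ℤ) (a : ι) :
    component t deg k (t a) = if deg a = k then t a else 0 := by
  rw [component, t.constr_basis]

lemma repr_component (k : ℤ) (x : g) (a : ι) :
    t.repr (component t deg k x) a = if deg a = k then t.repr x a else 0 := by
  have hcoord : t.coord a ∘ₗ component t deg k = if deg a = k then t.coord a else 0 := by
    classical
    refine t.ext fun b => ?_
    rw [LinearMap.comp_apply, component_basis]
    obtain rfl | hab := eq_or_ne b a
    · split_ifs <;> simp
    · split_ifs <;> simp [hab]
  have heq := LinearMap.congr_fun hcoord x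
  split_ifs at heq ⊢ <;> simpa using heq

variable [CharZero 𝕜]

lemma component_mem (ht : ∀ a, t a ∈ degSpace 𝕜 h (deg a)) (k : ℤ) (x : g) :
    component t deg k x ∈ degSpace 𝕜 h k := by
  rw [degSpace_eq_span ht, t.mem_span_image]
  intro a ha
  by_contra hne
  exact Finsupp.mem_support_iff.1 ha ((repr_component k x a).trans (if_neg hne))

lemma component_of_mem (ht : ∀ a, t a ∈ degSpace 𝕜 h (deg a)) (hx : x ∈ degSpace 𝕜 h k) :
    component t deg k x = x := by
  refine t.repr.injective (Finsupp.ext fun a => ?_)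
  rw [repr_component]
  split_ifs with ha
  · rfl
  · exact (repr_eq_zero_of_mem_degSpace ht hx ha).symm

lemma component_of_mem_of_ne (ht : ∀ a, t a ∈ degSpace 𝕜 h (deg a)) (hx : x ∈ degSpace 𝕜 h i)
    (hik : i ≠ k) : component t deg k x = 0 := by
  refine t.repr.injective (Finsupp.ext fun a => ?_)
  rw [repr_component, map_zero, Finsupp.zero_apply]
  split_ifs with ha
  · exact repr_eq_zero_of_mem_degSpace ht hx (ha.trans_ne hik.symm)
  · rfl

lemma component_map (ht : ∀ a, t a ∈ degSpace 𝕜 h (deg a)) {φ : g →ₗ[𝕜] g}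
    (hφ : ∀ i, ∀ x ∈ degSpace 𝕜 h i, φ x ∈ degSpace 𝕜 h (i + j)) (k : ℤ) (x : g) :
    component t deg (k + j) (φ x) = φ (component t deg k x) := by
  suffices component t deg (k + j) ∘ₗ φ = φ ∘ₗ component t deg k from LinearMap.congr_fun this x
  refine t.ext fun a => ?_
  rw [LinearMap.comp_apply, LinearMap.comp_apply, component_basis]
  split_ifs with ha
  · exact component_of_mem ht (ha ▸ hφ _ _ (ht a))
  · rw [map_zero]
    exact component_of_mem_of_ne ht (hφ _ _ (ht a)) (by omega)

lemma component_lie (ht : ∀ a, t a ∈ degSpace 𝕜 h (deg a)) (hy : y ∈ degSpace 𝕜 h j) (k : ℤ)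
    (x : g) : component t deg (k + j) ⁅y, x⁆ = ⁅y, component t deg k x⁆ :=
  component_map (φ := LieAlgebra.ad 𝕜 g y) ht
    (fun i _ hz => add_comm j i ▸ lie_mem_degSpace hy hz) k x

lemma eq_zero_of_mem_degSpace_of_two_le (htriple : IsSl2Triple h e f)
    (habel : ∀ k, 1 ≤ k → ∀ x ∈ degSpace 𝕜 h k, ⁅e, x⁆ = 0) (hk : 2 ≤ k)
    (hx : x ∈ degSpace 𝕜 h k) : x = 0 := by
  have hlie : ⁅e, ⁅f, x⁆⁆ = 0 :=
    habel (-1 + k) (by omega) _ (lie_mem_degSpace (f_mem_degSpace htriple) hx)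
  rw [leibniz_lie, htriple.lie_e_f, habel k (by omega) x hx, lie_zero, add_zero,
    mem_degSpace.1 hx] at hlie
  exact (smul_eq_zero.1 hlie).resolve_left
    (mul_ne_zero two_ne_zero (Int.cast_ne_zero.2 (by omega)))

end Grading

section ShortGrading

variable {𝕜 g ι : Type*} [Field 𝕜] [LieRing g] [LieAlgebra 𝕜 g]
  {t : Module.Basis ι 𝕜 g} {deg : ι → ℤ} {h e e' f x y : g}
  {k : ℤ}

/-- The basis `t` is homogeneous for the grading `g = g_{-1} ⊕ g_0 ⊕ g_1` by the eigenvalues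
of `ad (h / 2)`. -/
structure IsShortGrading (h : g) (t : Module.Basis ι 𝕜 g) (deg : ι → ℤ) : Prop where
  basis_mem : ∀ a, t a ∈ degSpace 𝕜 h (deg a)
  neg_one_le : ∀ a, -1 ≤ deg a
  le_one : ∀ a, deg a ≤ 1

namespace IsShortGrading

lemma sum_component (hG : IsShortGrading h t deg) (x : g) :
    component t deg (-1) x + component t deg 0 x + component t deg 1 x = x := by
  refine t.repr.injective (Finsupp.ext fun a => ?_)
  have hneg := hG.neg_one_le a
  have hpos := hG.le_one a
  obtain ha | ha | ha : deg a = -1 ∨ deg a = 0 ∨ deg a = 1 := by omega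
  all_goals simp [repr_component, ha]

variable [CharZero 𝕜]

lemma eq_zero_of_mem (hG : IsShortGrading h t deg) (hk : k < -1 ∨ 1 < k)
    (hx : x ∈ degSpace 𝕜 h k) : x = 0 := by
  refine t.repr.injective (Finsupp.ext fun a => ?_)
  rw [repr_eq_zero_of_mem_degSpace hG.basis_mem hx, map_zero, Finsupp.zero_apply]
  have := hG.neg_one_le a
  have := hG.le_one a
  omega

lemma lie_eq_zero (hG : IsShortGrading h t deg) (hx : x ∈ degSpace 𝕜 h 1)
    (hy : y ∈ degSpace 𝕜 h 1) : ⁅x, y⁆ = 0 :=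
  hG.eq_zero_of_mem (by norm_num) (lie_mem_degSpace hx hy)

lemma lie_eq_zero_of_neg (hG : IsShortGrading h t deg) (hx : x ∈ degSpace 𝕜 h (-1))
    (hy : y ∈ degSpace 𝕜 h (-1)) : ⁅x, y⁆ = 0 :=
  hG.eq_zero_of_mem (by norm_num) (lie_mem_degSpace hx hy)

lemma ad_pow_three (hG : IsShortGrading h t deg) (hy : y ∈ degSpace 𝕜 h 1) :
    LieAlgebra.ad 𝕜 g y ^ 3 = 0 := by
  refine t.ext fun a => ?_
  have hmem := lie_mem_degSpace hy (lie_mem_degSpace hy (lie_mem_degSpace hy (hG.basis_mem a)))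
  simpa [pow_succ] using
    hG.eq_zero_of_mem (by have := hG.neg_one_le a; omega) hmem

lemma isNilpotent_ad (hG : IsShortGrading h t deg) (hy : y ∈ degSpace 𝕜 h 1) :
    IsNilpotent (LieAlgebra.ad 𝕜 g y) :=
  ⟨3, hG.ad_pow_three hy⟩

lemma lie_lie_f (hG : IsShortGrading h t deg) (htriple : IsSl2Triple h e f)
    (hy : y ∈ degSpace 𝕜 h 1) : ⁅e, ⁅y, f⁆⁆ = (-2 : 𝕜) • y := by
  rw [leibniz_lie, hG.lie_eq_zero (e_mem_degSpace htriple) hy, zero_lie, zero_add,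
    htriple.lie_e_f, ← lie_skew, mem_degSpace.1 hy, ← neg_smul]
  norm_num

lemma e_unique (hG : IsShortGrading h t deg) (htriple : IsSl2Triple h e f)
    (htriple' : IsSl2Triple h e' f) : e' = e := by
  have hlie := hG.lie_lie_f htriple
    (sub_mem (e_mem_degSpace htriple') (e_mem_degSpace htriple))
  rw [sub_lie, htriple.lie_e_f, htriple'.lie_e_f, sub_self, lie_zero] at hlie
  exact sub_eq_zero.1 ((smul_eq_zero.1 hlie.symm).resolve_left (by norm_num))

end IsShortGrading

end ShortGrading

section GPlus

variable {g ι : Type*} [LieRing g] [LieAlgebra ℝ g] {B : LinearMap.BilinForm ℝ g}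
  {t : Module.Basis ι ℝ g} {deg : ι → ℤ} {h e f : g}

lemma degSpace_le_gPlus (ht : ∀ a, t a ∈ degSpace ℝ h (deg a)) {k : ℤ} (hk : 0 < k) :
    degSpace ℝ h k ≤ gPlus t deg := by
  rw [degSpace_eq_span ht]
  exact Submodule.span_mono (Set.image_mono fun _ ha => hk.trans_eq ha.symm)

lemma IsShortGrading.gPlus_eq (hG : IsShortGrading h t deg) : gPlus t deg = degSpace ℝ h 1 := by
  rw [gPlus, degSpace_eq_span hG.basis_mem]
  congr 2
  ext a
  exact ⟨(hG.le_one a).antisymm, one_pos.trans_eq ∘ Eq.symm⟩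

lemma isShortGrading_of_abelian (hB : B.lieInvariant g) (hnd : B.SeparatingLeft)
    (htriple : IsSl2Triple h e f) (ht : ∀ a, t a ∈ degSpace ℝ h (deg a))
    (habel : ∀ x ∈ gPlus t deg, ∀ y ∈ gPlus t deg, ⁅x, y⁆ = 0) : IsShortGrading h t deg := by
  have he : e ∈ gPlus t deg := degSpace_le_gPlus ht one_pos (e_mem_degSpace htriple)
  have hle : ∀ a, deg a ≤ 1 := fun a => by
    by_contra! ha
    exact t.ne_zero a (eq_zero_of_mem_degSpace_of_two_le htriple
      (fun k hk x hx => habel e he x (degSpace_le_gPlus ht (by omega) hx)) ha (ht a))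
  refine ⟨ht, fun a => ?_, hle⟩
  by_contra! ha
  -- A vector of degree below `-1` has no partner of the opposite degree under the metric.
  have horth : B (t a) = 0 := t.ext fun b =>
    form_eq_zero_of_mem_degSpace hB (ht a) (ht b) (by have := hle b; omega)
  exact t.ne_zero a (hnd _ fun y => by rw [horth, LinearMap.zero_apply])

end GPlus

section Exponential

variable {g ι : Type*} [LieRing g] [LieAlgebra ℝ g] {B : LinearMap.BilinForm ℝ g}
  {t : Module.Basis ι ℝ g} {deg : ι → ℤ} {h y z : g}

lemma expAd_eq_exp [Module ℚ (Module.End ℝ g)] (y x : g) :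
    expAd y x = IsNilpotent.exp (LieAlgebra.ad ℝ g y) x := by
  simp only [expAd, IsNilpotent.exp, LinearMap.sum_apply, ← LinearMap.smul_apply,
    inv_natCast_smul_eq ℚ ℝ]

lemma expAd_zero (x : g) : expAd 0 x = x := by
  let _ : Module ℚ (Module.End ℝ g) := Module.compHom _ (algebraMap ℚ ℝ)
  rw [expAd_eq_exp, map_zero, IsNilpotent.exp_zero, Module.End.one_apply]

lemma expAd_add (hy : IsNilpotent (LieAlgebra.ad ℝ g y)) (hz : IsNilpotent (LieAlgebra.ad ℝ g z))
    (hyz : ⁅y, z⁆ = 0) (x : g) : expAd (y + z) x = expAd y (expAd z x) := by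
  let _ : Module ℚ (Module.End ℝ g) := Module.compHom _ (algebraMap ℚ ℝ)
  have hcomm : Commute (LieAlgebra.ad ℝ g y) (LieAlgebra.ad ℝ g z) :=
    LinearMap.ext fun x => by simp [leibniz_lie y z, hyz]
  rw [expAd_eq_exp, expAd_eq_exp, expAd_eq_exp, map_add,
    IsNilpotent.exp_add_of_commute hcomm hy hz, Module.End.mul_apply]

/-- The automorphism `exp (ad y)`, for `ad y` nilpotent. -/
noncomputable def expAdEquiv (hy : IsNilpotent (LieAlgebra.ad ℝ g y)) : g ≃ₗ⁅ℝ⁆ g :=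
  letI : Module ℚ g := Module.compHom g (algebraMap ℚ ℝ)
  letI : LieAlgebra ℚ g := { lie_smul := fun q x z => lie_smul (q : ℝ) x z }
  (LieDerivation.ad ℝ g y).exp (by rwa [LieDerivation.coe_ad_apply_eq_ad_apply])

lemma expAdEquiv_apply (hy : IsNilpotent (LieAlgebra.ad ℝ g y)) (x : g) :
    expAdEquiv hy x = expAd y x := by
  let _ : Module ℚ g := Module.compHom g (algebraMap ℚ ℝ)
  rw [expAd_eq_exp, ← LieDerivation.coe_ad_apply_eq_ad_apply]
  rfl

lemma expAd_neg_expAd (hy : IsNilpotent (LieAlgebra.ad ℝ g y)) (x : g) :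
    expAd (-y) (expAd y x) = x := by
  have hy' : IsNilpotent (LieAlgebra.ad ℝ g (-y)) := by simpa only [map_neg] using hy.neg
  rw [← expAd_add hy' hy (by simp), neg_add_cancel, expAd_zero]

lemma nilpotencyClass_neg {A : Type*} [Ring A] (a : A) :
    nilpotencyClass (-a) = nilpotencyClass a := by
  refine congrArg sInf (Set.ext fun k => ?_)
  obtain hk | hk := k.even_or_odd <;> simp [hk.neg_pow]

lemma form_expAd_left (hB : B.lieInvariant g) (y u v : g) :
    B (expAd y u) v = B u (expAd (-y) v) := by
  have hpow : ∀ n : ℕ, ∀ u v : g, B ((LieAlgebra.ad ℝ g y ^ n) u) v =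
      B u (((-LieAlgebra.ad ℝ g y) ^ n) v) := fun n => by
    induction n with
    | zero => simp
    | succ n ih =>
      intro u v
      rw [pow_succ, pow_succ', Module.End.mul_apply, Module.End.mul_apply, ih,
        LieAlgebra.ad_apply, LinearMap.neg_apply, LieAlgebra.ad_apply, hB, map_neg (B u)]
  simp only [expAd, map_neg (LieAlgebra.ad ℝ g), nilpotencyClass_neg, map_sum,
    LinearMap.sum_apply, map_smul, LinearMap.smul_apply, hpow]

lemma form_expAd (hB : B.lieInvariant g) (hy : IsNilpotent (LieAlgebra.ad ℝ g y)) (u v : g) :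
    B (expAd y u) (expAd y v) = B u v := by
  rw [form_expAd_left hB, expAd_neg_expAd hy]

namespace IsShortGrading

lemma expAd_eq (hG : IsShortGrading h t deg) (hy : y ∈ degSpace ℝ h 1) (x : g) :
    expAd y x = x + ⁅y, x⁆ + (2⁻¹ : ℝ) • ⁅y, ⁅y, x⁆⁆ := by
  let _ : Module ℚ (Module.End ℝ g) := Module.compHom _ (algebraMap ℚ ℝ)
  rw [expAd_eq_exp, IsNilpotent.exp_eq_sum (hG.ad_pow_three hy)]
  simp [Finset.sum_range_succ, pow_succ, ← inv_natCast_smul_eq ℝ ℚ]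

lemma expAd_expAd (hG : IsShortGrading h t deg) (hy : y ∈ degSpace ℝ h 1)
    (hz : z ∈ degSpace ℝ h 1) (x : g) : expAd y (expAd z x) = expAd (y + z) x :=
  (expAd_add (hG.isNilpotent_ad hy) (hG.isNilpotent_ad hz) (hG.lie_eq_zero hy hz) x).symm

lemma component_neg_one_lie (hG : IsShortGrading h t deg) (hy : y ∈ degSpace ℝ h 1) (x : g) :
    component t deg (-1) ⁅y, x⁆ = 0 := by
  have hlie := component_lie hG.basis_mem hy (-2) x
  rwa [hG.eq_zero_of_mem (by norm_num) (component_mem hG.basis_mem (-2) x), lie_zero] at hlie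

lemma component_neg_one_expAd (hG : IsShortGrading h t deg) (hy : y ∈ degSpace ℝ h 1) (x : g) :
    component t deg (-1) (expAd y x) = component t deg (-1) x := by
  rw [hG.expAd_eq hy, map_add, map_add, map_smul, hG.component_neg_one_lie hy,
    hG.component_neg_one_lie hy, smul_zero, add_zero, add_zero]

lemma component_zero_expAd (hG : IsShortGrading h t deg) (hy : y ∈ degSpace ℝ h 1) (x : g) :
    component t deg 0 (expAd y x) = component t deg 0 x + ⁅y, component t deg (-1) x⁆ := by
  have hlie := component_lie hG.basis_mem hy (-1)
  norm_num at hlie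
  rw [hG.expAd_eq hy, map_add, map_add, map_smul, hlie, hlie, hG.component_neg_one_lie hy,
    lie_zero, smul_zero, add_zero]

end IsShortGrading
end Exponential

section GaugeFixing

variable {g ι κ : Type*} [LieRing g] [LieAlgebra ℝ g] {t : Module.Basis ι ℝ g} {deg : ι → ℤ}
  {h e f X y z : g} {σ : κ → ℤ} {ℓ : κ → g}

lemma IsHighestWeightBasis.mem_span_iff (hℓ : IsHighestWeightBasis h e σ ℓ) :
    z ∈ Submodule.span ℝ (Set.range ℓ) ↔ ⁅e, z⁆ = 0 := by
  rw [hℓ.span_eq, LinearMap.mem_ker, LieAlgebra.ad_apply]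

/-- The parameter `y` of the gauge transformation `exp y` which brings `X` to the highest weight
gauge with respect to `e = t^+`. -/
noncomputable def gaugeParam (t : Module.Basis ι ℝ g) (deg : ι → ℤ) (e X : g) : g :=
  (2⁻¹ : ℝ) • ⁅e, component t deg 0 X⁆

/-- The highest weight gauge of `X`, that is, the point of the `G_+`-orbit of `X` at which
`⁅t^+, X - t^-⁆ = 0`. -/
noncomputable def gaugeFix (t : Module.Basis ι ℝ g) (deg : ι → ℤ) (e X : g) : g :=
  expAd (gaugeParam t deg e X) X

namespace IsShortGrading

lemma gaugeParam_mem (hG : IsShortGrading h t deg) (he : e ∈ degSpace ℝ h 1) (X : g) :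
    gaugeParam t deg e X ∈ degSpace ℝ h 1 := by
  have hmem := lie_mem_degSpace he (component_mem hG.basis_mem 0 X)
  rw [add_zero] at hmem
  exact Submodule.smul_mem _ _ hmem

lemma lie_e_expAd_sub_f (hG : IsShortGrading h t deg) (htriple : IsSl2Triple h e f)
    (hX : component t deg (-1) X = f) (hy : y ∈ degSpace ℝ h 1) :
    ⁅e, expAd y X - f⁆ = (2 : ℝ) • (gaugeParam t deg e X - y) := by
  have hpos : ⁅e, component t deg 1 (expAd y X)⁆ = 0 :=
    hG.lie_eq_zero (e_mem_degSpace htriple) (component_mem hG.basis_mem _ _)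
  rw [← hG.sum_component (expAd y X), hG.component_neg_one_expAd hy, hG.component_zero_expAd hy,
    hX, gaugeParam]
  simp only [lie_add, lie_sub, hpos, hG.lie_lie_f htriple hy]
  module

lemma lie_e_expAd_sub_f_eq_zero_iff (hG : IsShortGrading h t deg) (htriple : IsSl2Triple h e f)
    (hX : component t deg (-1) X = f) (hy : y ∈ degSpace ℝ h 1) :
    ⁅e, expAd y X - f⁆ = 0 ↔ y = gaugeParam t deg e X := by
  rw [hG.lie_e_expAd_sub_f htriple hX hy, smul_eq_zero_iff_right two_ne_zero, sub_eq_zero,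
    eq_comm]

lemma lie_e_gaugeFix_sub_f (hG : IsShortGrading h t deg) (htriple : IsSl2Triple h e f)
    (hX : component t deg (-1) X = f) : ⁅e, gaugeFix t deg e X - f⁆ = 0 :=
  (hG.lie_e_expAd_sub_f_eq_zero_iff htriple hX
    (hG.gaugeParam_mem (e_mem_degSpace htriple) X)).2 rfl

lemma gaugeFix_expAd (hG : IsShortGrading h t deg) (htriple : IsSl2Triple h e f)
    (hX : component t deg (-1) X = f) (hy : y ∈ degSpace ℝ h 1) :
    gaugeFix t deg e (expAd y X) = gaugeFix t deg e X := by
  have hX' : component t deg (-1) (expAd y X) = f := by rw [hG.component_neg_one_expAd hy, hX]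
  have hz := hG.gaugeParam_mem (e_mem_degSpace htriple) (expAd y X)
  have hfix := hG.lie_e_gaugeFix_sub_f htriple hX'
  rw [gaugeFix, hG.expAd_expAd hz hy,
    hG.lie_e_expAd_sub_f_eq_zero_iff htriple hX (add_mem hz hy)] at hfix
  rw [gaugeFix, hG.expAd_expAd hz hy, hfix, gaugeFix]

variable [Fintype κ]

lemma eq_gaugeParam (hG : IsShortGrading h t deg) (htriple : IsSl2Triple h e f)
    (hℓ : IsHighestWeightBasis h e σ ℓ) (hX : component t deg (-1) X = f)
    (hy : y ∈ degSpace ℝ h 1) {w : κ → ℝ} (hw : expAd y X = f + ∑ s, w s • ℓ s) :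
    y = gaugeParam t deg e X := by
  rw [← hG.lie_e_expAd_sub_f_eq_zero_iff htriple hX hy, ← hℓ.mem_span_iff, hw,
    add_sub_cancel_left]
  exact (Submodule.mem_span_range_iff_exists_fun ℝ).2 ⟨w, rfl⟩

lemma existsUnique_expAd_eq (hG : IsShortGrading h t deg) (htriple : IsSl2Triple h e f)
    (hℓ : IsHighestWeightBasis h e σ ℓ) (hX : component t deg (-1) X = f) :
    ∃! p : gPlus t deg × (κ → ℝ), expAd (p.1 : g) X = f + ∑ s, p.2 s • ℓ s := by
  obtain ⟨w, hw⟩ := (Submodule.mem_span_range_iff_exists_fun ℝ).1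
    (hℓ.mem_span_iff.2 (hG.lie_e_gaugeFix_sub_f htriple hX))
  have hy : gaugeParam t deg e X ∈ gPlus t deg :=
    hG.gPlus_eq ▸ hG.gaugeParam_mem (e_mem_degSpace htriple) X
  refine ⟨(⟨gaugeParam t deg e X, hy⟩, w), (add_eq_of_eq_sub' hw).symm, ?_⟩
  rintro ⟨⟨y, hy'⟩, v⟩ hv
  obtain rfl := hG.eq_gaugeParam htriple hℓ hX (hG.gPlus_eq ▸ hy') hv
  have hvw : ∑ s, v s • ℓ s = ∑ s, w s • ℓ s := hw ▸ (sub_eq_of_eq_add' hv).symm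
  exact Prod.ext rfl (funext (hℓ.linearIndependent.eq_coords_of_eq hvw))

end IsShortGrading

end GaugeFixing

section Coordinates

variable {g ι κ : Type*} [LieRing g] [LieAlgebra ℝ g] [Fintype ι]
  {t : Module.Basis ι ℝ g} {deg : ι → ℤ} {h e f X : g}

lemma total_eq_equivFun_symm (t : Module.Basis ι ℝ g) (x : ι → ℝ) :
    total t x = t.equivFun.symm x :=
  (t.equivFun_symm_apply x).symm

lemma equivFun_total (t : Module.Basis ι ℝ g) (x : ι → ℝ) : t.equivFun (total t x) = x := by
  rw [total_eq_equivFun_symm, LinearEquiv.apply_symm_apply]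

lemma repr_total (x : ι → ℝ) (a : ι) : t.repr (total t x) a = x a :=
  congrFun (equivFun_total t x) a

lemma repr_negElt (c : NegIdx deg → ℝ) (a : ι) :
    t.repr (negElt t deg c) a = if ha : deg a < 0 then c ⟨a, ha⟩ else 0 := by
  classical
  simp only [negElt, map_sum, map_smul, Module.Basis.repr_self, Finsupp.smul_single,
    Finsupp.finsetSum_apply, Finsupp.single_apply]
  split_ifs with ha
  · rw [Fintype.sum_eq_single ⟨a, ha⟩ fun α hα => ?_]
    · simp
    · exact if_neg fun hαa : (α : ι) = a => hα (Subtype.ext hαa)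
  · exact Finset.sum_eq_zero fun α _ => if_neg fun hαa : (α : ι) = a => ha (hαa ▸ α.2)

lemma negCoord_equivFun_negElt (c : NegIdx deg → ℝ) :
    negCoord deg (t.equivFun (negElt t deg c)) = c := by
  funext α
  rw [negCoord, Module.Basis.equivFun_apply, repr_negElt, dif_pos α.2]

/-- The coordinates of degree `≥ 0`. -/
noncomputable def nonnegCoord (t : Module.Basis ι ℝ g) (deg : ι → ℤ) (X : g) : NonnegIdx deg → ℝ :=
  fun a => t.repr X a

lemma nonnegCoord_total_constrPt (u : NonnegIdx deg → ℝ) :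
    nonnegCoord t deg (total t (constrPt t deg f u)) = u := by
  funext a
  rw [nonnegCoord, repr_total, constrPt, dif_pos a.2]

namespace IsShortGrading

lemma component_neg_one_total (hG : IsShortGrading h t deg) (x : ι → ℝ) :
    component t deg (-1) (total t x) = negElt t deg (negCoord deg x) := by
  refine t.repr.injective (Finsupp.ext fun a => ?_)
  have := hG.neg_one_le a
  rw [repr_component, repr_total, repr_negElt]
  split_ifs <;> first | rfl | omega

lemma total_constrPt_nonnegCoord (hG : IsShortGrading h t deg)
    (hX : component t deg (-1) X = f) : total t (constrPt t deg f (nonnegCoord t deg X)) = X := by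
  refine t.repr.injective (Finsupp.ext fun a => ?_)
  have := hG.neg_one_le a
  rw [repr_total, constrPt]
  split_ifs with ha
  · rfl
  · rw [← hX, repr_component, if_pos (by omega)]

lemma component_neg_one_total_constrPt (hG : IsShortGrading h t deg)
    (hf : f ∈ degSpace ℝ h (-1)) (u : NonnegIdx deg → ℝ) :
    component t deg (-1) (total t (constrPt t deg f u)) = f := by
  refine t.repr.injective (Finsupp.ext fun a => ?_)
  rw [repr_component, repr_total, constrPt]
  split_ifs with ha ha'
  · omega
  · rfl
  · exact (repr_eq_zero_of_mem_degSpace hG.basis_mem hf ha).symm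

lemma existsUnique_highestWeightForm [Fintype κ] (hG : IsShortGrading h t deg) {σ : κ → ℤ}
    {ℓ : κ → (NegIdx deg → ℝ) → g} {x : ι → ℝ}
    (htriple : IsSl2Triple h e (negElt t deg (negCoord deg x)))
    (hℓ : IsHighestWeightBasis h e σ (fun s => ℓ s (negCoord deg x))) :
    ∃! p : gPlus t deg × (κ → ℝ), IsHighestWeightForm t deg ℓ x (p.1 : g) p.2 :=
  hG.existsUnique_expAd_eq htriple hℓ (hG.component_neg_one_total x)

end IsShortGrading

end Coordinates

section PolynomialMaps

variable {𝕜 M N K ν : Type*}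

lemma exists_linearMap_sum_smul_eq {κ : Type*} [Fintype κ] [Field 𝕜] [AddCommGroup M]
    [Module 𝕜 M] {ℓ : κ → M} (hℓ : LinearIndependent 𝕜 ℓ) :
    ∃ L : M →ₗ[𝕜] κ → 𝕜, ∀ x ∈ Submodule.span 𝕜 (Set.range ℓ), ∑ s, L x s • ℓ s = x := by
  obtain ⟨L, hL⟩ := LinearMap.exists_leftInverse_of_injective (Fintype.linearCombination 𝕜 ℓ)
    (LinearMap.ker_eq_bot.2 (linearIndependent_iff_injective_fintypeLinearCombination.1 hℓ))
  refine ⟨L, fun x hx => ?_⟩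
  obtain ⟨c, rfl⟩ := (Submodule.mem_span_range_iff_exists_fun 𝕜).1 hx
  have hLc : L (∑ s, c s • ℓ s) = c := LinearMap.congr_fun hL c
  rw [hLc]

/-- A map into a module whose composite with every linear functional is a polynomial function. -/
def IsPolynomialMap [CommSemiring 𝕜] [AddCommMonoid M] [Module 𝕜 M] (v : (ν → 𝕜) → M) : Prop :=
  ∀ φ : Module.Dual 𝕜 M, ∃ P : MvPolynomial ν 𝕜, ∀ u, MvPolynomial.eval u P = φ (v u)

namespace IsPolynomialMap

section Ring

variable [CommRing 𝕜] [AddCommGroup M] [Module 𝕜 M] [AddCommGroup N] [Module 𝕜 N]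
  [AddCommGroup K] [Module 𝕜 K] {v v' : (ν → 𝕜) → M} {w : (ν → 𝕜) → N}

lemma const (x : M) : IsPolynomialMap fun _ : ν → 𝕜 => x :=
  fun φ => ⟨MvPolynomial.C (φ x), fun _ => MvPolynomial.eval_C _⟩

lemma add (hv : IsPolynomialMap v) (hv' : IsPolynomialMap v') :
    IsPolynomialMap fun u => v u + v' u := fun φ => by
  obtain ⟨P, hP⟩ := hv φ
  obtain ⟨P', hP'⟩ := hv' φ
  exact ⟨P + P', fun u => by rw [map_add, map_add, hP, hP']⟩

lemma map (hv : IsPolynomialMap v) (T : M →ₗ[𝕜] N) : IsPolynomialMap fun u => T (v u) :=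
  fun φ => hv (φ ∘ₗ T)

lemma map₂ [Module.Free 𝕜 M] [Module.Finite 𝕜 M] [Module.Free 𝕜 N] [Module.Finite 𝕜 N]
    (hv : IsPolynomialMap v) (hw : IsPolynomialMap w) (β : M →ₗ[𝕜] N →ₗ[𝕜] K) :
    IsPolynomialMap fun u => β (v u) (w u) := fun φ => by
  let b := Module.Free.chooseBasis 𝕜 M
  let b' := Module.Free.chooseBasis 𝕜 N
  choose P hP using fun i => hv (b.coord i)
  choose Q hQ using fun j => hw (b'.coord j)
  refine ⟨∑ j, ∑ i, Q j * (P i * MvPolynomial.C (φ (β (b i) (b' j)))), fun u => ?_⟩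
  change _ = φ (β (v u) (w u))
  conv_rhs => rw [← b.sum_repr (v u), ← b'.sum_repr (w u)]
  simp only [map_sum, map_mul, map_smul, LinearMap.sum_apply, LinearMap.smul_apply, smul_eq_mul,
    MvPolynomial.eval_C, hP, hQ, Module.Basis.coord_apply, Finset.mul_sum]

end Ring

lemma exists_coeff {κ : Type*} [Fintype κ] [Field 𝕜] [AddCommGroup M] [Module 𝕜 M]
    {v : (ν → 𝕜) → M} (hv : IsPolynomialMap v) {ℓ : κ → M} (hℓ : LinearIndependent 𝕜 ℓ)
    (hmem : ∀ u, v u ∈ Submodule.span 𝕜 (Set.range ℓ)) :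
    ∃ P : κ → MvPolynomial ν 𝕜, ∀ u, v u = ∑ s, MvPolynomial.eval u (P s) • ℓ s := by
  obtain ⟨L, hL⟩ := exists_linearMap_sum_smul_eq hℓ
  choose P hP using fun s => hv (LinearMap.proj s ∘ₗ L)
  refine ⟨P, fun u => ?_⟩
  simp only [hP, LinearMap.comp_apply, LinearMap.proj_apply, hL _ (hmem u)]

end IsPolynomialMap

end PolynomialMaps

section Generators

variable {g ι κ : Type*} [LieRing g] [LieAlgebra ℝ g] [Fintype ι] [Fintype κ]
  {t : Module.Basis ι ℝ g} {deg : ι → ℤ} {h e f X y : g} {σ : κ → ℤ} {ℓ : κ → g}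

omit [Fintype ι] [Fintype κ] in
lemma IsHighestWeightBasis.weight_nonneg [Module.Finite ℝ g] (hℓ : IsHighestWeightBasis h e σ ℓ)
    (htriple : IsSl2Triple h e f) (s : κ) : 0 ≤ σ s := by
  have hprim : htriple.HasPrimitiveVectorWith (ℓ s) (2 * (σ s : ℝ)) :=
    { ne_zero := hℓ.linearIndependent.ne_zero s
      lie_h := hℓ.weight s
      lie_e := hℓ.mem_span_iff.1 (Submodule.subset_span (Set.mem_range_self s)) }
  obtain ⟨n, hn⟩ := hprim.exists_nat
  have hσ : (0 : ℝ) ≤ σ s := by linarith [n.cast_nonneg (α := ℝ)]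
  exact_mod_cast hσ

lemma IsShortGrading.mem_wAlgebra_iff (hG : IsShortGrading h t deg) (hf : f ∈ degSpace ℝ h (-1))
    {p : MvPolynomial (NonnegIdx deg) ℝ} :
    p ∈ wAlgebra t deg f ↔ ∀ y ∈ degSpace ℝ h 1, ∀ X, component t deg (-1) X = f →
      MvPolynomial.eval (nonnegCoord t deg (expAd y X)) p =
        MvPolynomial.eval (nonnegCoord t deg X) p := by
  refine ⟨fun hp y hy X hX => hp y (hG.gPlus_eq ▸ hy) _ _ ?_, fun hp y hy u u' huu' => ?_⟩
  · rw [hG.total_constrPt_nonnegCoord hX, hG.total_constrPt_nonnegCoord]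
    rw [hG.component_neg_one_expAd hy, hX]
  · have hinv := hp y (hG.gPlus_eq ▸ hy) _ (hG.component_neg_one_total_constrPt hf u)
    rwa [← huu', nonnegCoord_total_constrPt, nonnegCoord_total_constrPt] at hinv

lemma isPolynomialMap_total_constrPt (t : Module.Basis ι ℝ g) (deg : ι → ℤ) (f : g) :
    IsPolynomialMap fun u => total t (constrPt t deg f u) := fun φ => by
  refine ⟨∑ a, (if ha : 0 ≤ deg a then MvPolynomial.X ⟨a, ha⟩ else
    MvPolynomial.C (t.repr f a)) * MvPolynomial.C (φ (t a)), fun u => ?_⟩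
  simp only [total, map_sum, map_smul, map_mul, MvPolynomial.eval_C, smul_eq_mul]
  refine Finset.sum_congr rfl fun a _ => ?_
  rw [constrPt]
  split_ifs <;> simp only [MvPolynomial.eval_X, MvPolynomial.eval_C]

lemma IsShortGrading.isPolynomialMap_gaugeFix (hG : IsShortGrading h t deg)
    (he : e ∈ degSpace ℝ h 1) :
    IsPolynomialMap fun u => gaugeFix t deg e (total t (constrPt t deg f u)) := by
  have : Module.Finite ℝ g := Module.Finite.of_basis t
  let lie : g →ₗ[ℝ] g →ₗ[ℝ] g := (LieAlgebra.ad ℝ g : g →ₗ[ℝ] Module.End ℝ g)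
  have hX := isPolynomialMap_total_constrPt t deg f
  have hy : IsPolynomialMap fun u => gaugeParam t deg e (total t (constrPt t deg f u)) :=
    hX.map ((2⁻¹ : ℝ) • lie e ∘ₗ component t deg 0)
  have hyX := hy.map₂ hX lie
  have hsum := (hX.add hyX).add ((hy.map₂ hyX lie).map ((2⁻¹ : ℝ) • LinearMap.id))
  refine fun φ => (hsum φ).imp fun P hP u => ?_
  rw [hP]
  exact congrArg φ (hG.expAd_eq (hG.gaugeParam_mem he _) _).symm

lemma IsShortGrading.exists_isGaugeGenerators (hG : IsShortGrading h t deg)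
    (htriple : IsSl2Triple h e f) (hℓ : IsHighestWeightBasis h e σ ℓ) :
    ∃ W : κ → wAlgebra t deg f, IsGaugeGenerators t deg f ℓ W := by
  have he := e_mem_degSpace (𝕜 := ℝ) htriple
  have hcomp := hG.component_neg_one_total_constrPt (f_mem_degSpace htriple)
  have hpoly := (hG.isPolynomialMap_gaugeFix (f := f) he).add (.const (-f))
  obtain ⟨P, hP⟩ := hpoly.exists_coeff hℓ.linearIndependent fun u => by
    rw [hℓ.mem_span_iff, ← sub_eq_add_neg]
    exact hG.lie_e_gaugeFix_sub_f htriple (hcomp u)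
  refine ⟨fun s => ⟨P s, fun y hy u u' huu' => ?_⟩,
    fun u => ⟨gaugeParam t deg e (total t (constrPt t deg f u)), ?_, ?_⟩⟩
  · have hfix := hG.gaugeFix_expAd htriple (hcomp u) (hG.gPlus_eq ▸ hy)
    have hsum : ∑ s, MvPolynomial.eval u' (P s) • ℓ s = ∑ s, MvPolynomial.eval u (P s) • ℓ s := by
      rw [← hP, ← hP, huu', hfix]
    exact hℓ.linearIndependent.eq_coords_of_eq hsum s
  · exact hG.gPlus_eq ▸ hG.gaugeParam_mem he (total t (constrPt t deg f u))
  · change gaugeFix t deg e _ = f + ∑ s, MvPolynomial.eval u (P s) • ℓ s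
    rw [← hP]
    abel

omit [Fintype ι] in
lemma IsShortGrading.component_neg_one_slice [Finite ι] (hG : IsShortGrading h t deg)
    (htriple : IsSl2Triple h e f) (hℓ : IsHighestWeightBasis h e σ ℓ) (w : κ → ℝ) :
    component t deg (-1) (f + ∑ s, w s • ℓ s) = f := by
  have : Module.Finite ℝ g := Module.Finite.of_basis t
  have hzero : ∀ s, component t deg (-1) (ℓ s) = 0 := fun s =>
    component_of_mem_of_ne hG.basis_mem (mem_degSpace.2 (hℓ.weight s))
      (by linarith [hℓ.weight_nonneg htriple s])
  rw [map_add, component_of_mem hG.basis_mem (f_mem_degSpace htriple), map_sum]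
  simp only [map_smul, hzero, smul_zero, Finset.sum_const_zero, add_zero]

/-- The restriction to the highest weight gauge `f + ∑ s, w s • ℓ s` of a polynomial in the
coordinates of degree `≥ 0`, as a polynomial in the `w s`. -/
noncomputable def sliceRestriction (t : Module.Basis ι ℝ g) (deg : ι → ℤ) (f : g) (ℓ : κ → g) :
    MvPolynomial (NonnegIdx deg) ℝ →ₐ[ℝ] MvPolynomial κ ℝ :=
  MvPolynomial.aeval fun a =>
    MvPolynomial.C (t.repr f a) + ∑ s, MvPolynomial.C (t.repr (ℓ s) a) * MvPolynomial.X s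

omit [Fintype ι] in
lemma eval_sliceRestriction (p : MvPolynomial (NonnegIdx deg) ℝ) (w : κ → ℝ) :
    MvPolynomial.eval w (sliceRestriction t deg f ℓ p) =
      MvPolynomial.eval (nonnegCoord t deg (f + ∑ s, w s • ℓ s)) p := by
  refine (MvPolynomial.comp_aeval_apply _ (MvPolynomial.aeval w) p).trans ?_
  refine congrArg (MvPolynomial.eval · p) (funext fun a => ?_)
  simp [nonnegCoord, mul_comm]

namespace IsGaugeGenerators

variable {W : κ → wAlgebra t deg f}

lemma eval_eq_of_expAd_eq (hW : IsGaugeGenerators t deg f ℓ W) (hG : IsShortGrading h t deg)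
    (htriple : IsSl2Triple h e f) (hℓ : IsHighestWeightBasis h e σ ℓ)
    (hX : component t deg (-1) X = f) (hy : y ∈ degSpace ℝ h 1) {w : κ → ℝ}
    (hw : expAd y X = f + ∑ s, w s • ℓ s) (s : κ) :
    MvPolynomial.eval (nonnegCoord t deg X) (W s).1 = w s := by
  obtain ⟨z, hz, hzW⟩ := hW (nonnegCoord t deg X)
  rw [hG.total_constrPt_nonnegCoord hX] at hzW
  have heq := (hG.existsUnique_expAd_eq htriple hℓ hX).unique
    (y₁ := (⟨z, hz⟩, _)) (y₂ := (⟨y, hG.gPlus_eq ▸ hy⟩, _)) hzW hw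
  exact congrFun (Prod.ext_iff.1 heq).2 s

lemma eval_eq_eval_slice (hW : IsGaugeGenerators t deg f ℓ W) (hG : IsShortGrading h t deg)
    (p : wAlgebra t deg f) (hX : component t deg (-1) X = f) :
    MvPolynomial.eval (nonnegCoord t deg X) p.1 = MvPolynomial.eval
      (fun s => MvPolynomial.eval (nonnegCoord t deg X) (W s).1)
      (sliceRestriction t deg f ℓ p.1) := by
  obtain ⟨z, hz, hzW⟩ := hW (nonnegCoord t deg X)
  rw [eval_sliceRestriction, ← hzW]
  refine (p.2 z hz _ _ ?_).symm
  rw [hG.total_constrPt_nonnegCoord hX, hG.total_constrPt_nonnegCoord]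
  rw [hG.component_neg_one_expAd (hG.gPlus_eq ▸ hz), hX]

lemma aeval_sliceRestriction (hW : IsGaugeGenerators t deg f ℓ W) (hG : IsShortGrading h t deg)
    (hf : f ∈ degSpace ℝ h (-1)) (p : wAlgebra t deg f) :
    MvPolynomial.aeval W (sliceRestriction t deg f ℓ p.1) = p := by
  refine Subtype.ext (MvPolynomial.funext fun u => ?_)
  have hslice := hW.eval_eq_eval_slice hG p (hG.component_neg_one_total_constrPt hf u)
  rw [nonnegCoord_total_constrPt] at hslice
  rw [hslice]
  exact MvPolynomial.comp_aeval_apply W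
    ((MvPolynomial.aeval u).comp (wAlgebra t deg f).val) (sliceRestriction t deg f ℓ p.1)

lemma adjoin_eq_top (hW : IsGaugeGenerators t deg f ℓ W) (hG : IsShortGrading h t deg)
    (hf : f ∈ degSpace ℝ h (-1)) : Algebra.adjoin ℝ (Set.range W) = ⊤ := by
  rw [Algebra.adjoin_range_eq_range_aeval, AlgHom.range_eq_top]
  exact fun p => ⟨_, hW.aeval_sliceRestriction hG hf p⟩

lemma sliceRestriction_apply (hW : IsGaugeGenerators t deg f ℓ W) (hG : IsShortGrading h t deg)
    (htriple : IsSl2Triple h e f) (hℓ : IsHighestWeightBasis h e σ ℓ) (s : κ) :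
    sliceRestriction t deg f ℓ (W s).1 = MvPolynomial.X s := by
  refine MvPolynomial.funext fun w => ?_
  rw [eval_sliceRestriction, MvPolynomial.eval_X]
  exact hW.eval_eq_of_expAd_eq hG htriple hℓ (hG.component_neg_one_slice htriple hℓ w)
    (zero_mem _) (expAd_zero _) s

end IsGaugeGenerators

end Generators

section Poisson

variable {g ι : Type*} [LieRing g] [LieAlgebra ℝ g] [Fintype ι] [DecidableEq ι]
  {B : LinearMap.BilinForm ℝ g} {t : Module.Basis ι ℝ g} {deg : ι → ℤ} {h y : g}
  {F H P Q : (ι → ℝ) → ℝ} {x : ι → ℝ} {ψ : g ≃ₗ⁅ℝ⁆ g}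

/-- The basis `t_a = η_{ab} t^b` dual to `t` with respect to the form `B`. -/
noncomputable def dualVec (B : LinearMap.BilinForm ℝ g) (t : Module.Basis ι ℝ g) (a : ι) : g :=
  ∑ b, (metric B t)⁻¹ a b • t b

/-- The gradient `(∂F/∂J_a) t_a` of a function of the coordinates, with respect to the form `B`. -/
noncomputable def grad (B : LinearMap.BilinForm ℝ g) (t : Module.Basis ι ℝ g) (F : (ι → ℝ) → ℝ)
    (x : ι → ℝ) : g :=
  ∑ a, fderiv ℝ F x (Pi.single a 1) • dualVec B t a

lemma form_lie_dualVec (a b c : ι) :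
    B (t c) ⁅dualVec B t a, dualVec B t b⁆ = lowStruct B t a b c := by
  have hform : ∀ d e, B (t c) ⁅t d, t e⁆ = ∑ k, metric B t c k * t.repr ⁅t d, t e⁆ k := by
    intro d e
    conv_lhs => rw [← t.sum_repr ⁅t d, t e⁆]
    simp only [map_sum, map_smul, smul_eq_mul, metric, Matrix.of_apply, mul_comm]
  simp only [dualVec, lowStruct, sum_lie_sum, smul_lie, lie_smul, map_sum, map_smul, smul_eq_mul,
    hform, Finset.mul_sum]
  exact Finset.sum_congr rfl fun d _ => Finset.sum_congr rfl fun e _ =>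
    Finset.sum_congr rfl fun k _ => by ring

lemma poisson_eq_form_lie_grad (F H : (ι → ℝ) → ℝ) (x : ι → ℝ) :
    poisson B t F H x = B (total t x) ⁅grad B t F x, grad B t H x⁆ := by
  have hdual : ∀ a b, B (total t x) ⁅dualVec B t a, dualVec B t b⁆ =
      ∑ c, lowStruct B t a b c * x c := fun a b => by
    simp only [total, map_sum, map_smul, LinearMap.sum_apply, LinearMap.smul_apply, smul_eq_mul,
      form_lie_dualVec, mul_comm]
  simp only [poisson, grad, ← hdual, sum_lie_sum, smul_lie, lie_smul, map_sum, map_smul,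
    smul_eq_mul]
  exact Finset.sum_congr rfl fun a _ => Finset.sum_congr rfl fun b _ => by ring

lemma form_dualVec (hnd : B.Nondegenerate) (a b : ι) :
    B (dualVec B t a) (t b) = if a = b then 1 else 0 := by
  have hmetric : metric B t = LinearMap.BilinForm.toMatrix t B := by
    ext; simp [metric]
  have hdet : IsUnit (metric B t).det := by
    rw [isUnit_iff_ne_zero, hmetric]
    exact (LinearMap.BilinForm.nondegenerate_iff_det_ne_zero t).1 hnd
  have hinv := congrFun₂ (Matrix.nonsing_inv_mul _ hdet) a b
  rw [Matrix.mul_apply, Matrix.one_apply] at hinv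
  simp only [dualVec, map_sum, map_smul, LinearMap.sum_apply, LinearMap.smul_apply, smul_eq_mul,
    ← hinv, metric, Matrix.of_apply]

lemma form_grad (hnd : B.Nondegenerate) (F : (ι → ℝ) → ℝ) (x : ι → ℝ) (z : g) :
    B (grad B t F x) z = fderiv ℝ F x (t.equivFun z) := by
  suffices B (grad B t F x) = (fderiv ℝ F x : (ι → ℝ) →ₗ[ℝ] ℝ) ∘ₗ (t.equivFun : g →ₗ[ℝ] ι → ℝ) from
    LinearMap.congr_fun this z
  refine t.ext fun b => ?_
  simp [grad, form_dualVec hnd, Finsupp.single_eq_pi_single]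

lemma grad_coord_mem (hB : B.lieInvariant g) (hnd : B.Nondegenerate)
    (ht : ∀ a, t a ∈ degSpace ℝ h (deg a)) (b : ι) :
    grad B t (fun z => z b) x ∈ degSpace ℝ h (-deg b) := by
  refine mem_degSpace_of_form hB hnd.1 ht fun a ha => ?_
  rw [neg_neg] at ha
  rw [form_grad hnd, (hasFDerivAt_apply b x).fderiv]
  simp [ne_of_apply_ne deg ha]

/-- `F` corresponds under the automorphism `ψ` to the function `P`, on the points with the same
coordinates of negative degree as `x`, and is invariant under the gauge transformations of `x`. -/
structure IsInvariantLift (t : Module.Basis ι ℝ g) (deg : ι → ℤ) (h : g) (ψ : g ≃ₗ⁅ℝ⁆ g)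
    (F P : (ι → ℝ) → ℝ) (x : ι → ℝ) : Prop where
  differentiableAt : DifferentiableAt ℝ F x
  differentiableAt_base : DifferentiableAt ℝ P (t.equivFun (ψ.symm (total t x)))
  eq_comp : ∀ z, negCoord deg z = negCoord deg x → F z = P (t.equivFun (ψ.symm (total t z)))
  invariant : ∀ y ∈ degSpace ℝ h 1, F (t.equivFun (expAd y (total t x))) = F x

omit [DecidableEq ι] in
lemma fderiv_lie_eq_zero_of_invariant (hG : IsShortGrading h t deg) (hF : DifferentiableAt ℝ F x)
    (hinv : ∀ y ∈ degSpace ℝ h 1, F (t.equivFun (expAd y (total t x))) = F x)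
    (hy : y ∈ degSpace ℝ h 1) : fderiv ℝ F x (t.equivFun ⁅y, total t x⁆) = 0 := by
  have hpath : ∀ s : ℝ, x + s • t.equivFun ⁅y, total t x⁆ +
      s ^ 2 • t.equivFun ((2⁻¹ : ℝ) • ⁅y, ⁅y, total t x⁆⁆) =
        t.equivFun (expAd (s • y) (total t x)) := fun s => by
    rw [hG.expAd_eq (Submodule.smul_mem _ _ hy), map_add, map_add, equivFun_total]
    simp only [smul_lie, lie_smul, map_smul]
    module
  have hderiv := (((hasDerivAt_id (0 : ℝ)).smul_const (t.equivFun ⁅y, total t x⁆)).const_add x).add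
    (((hasDerivAt_id (0 : ℝ)).pow 2).smul_const (t.equivFun ((2⁻¹ : ℝ) • ⁅y, ⁅y, total t x⁆⁆)))
  have hcomp := hF.hasFDerivAt.comp_hasDerivAt_of_eq (0 : ℝ) hderiv (by simp)
  refine (hcomp.congr_deriv (by simp)).unique ((hasDerivAt_const 0 (F x)).congr_of_eventuallyEq
    (.of_forall fun s => ?_))
  exact (congrArg F (hpath s)).trans (hinv _ (Submodule.smul_mem _ _ hy))

namespace IsInvariantLift

lemma form_lie_grad_eq_zero (hF : IsInvariantLift t deg h ψ F P x) (hB : B.lieInvariant g)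
    (hsymm : B.IsSymm) (hnd : B.Nondegenerate) (hG : IsShortGrading h t deg)
    (hy : y ∈ degSpace ℝ h 1) : B (total t x) ⁅y, grad B t F x⁆ = 0 := by
  have hzero := fderiv_lie_eq_zero_of_invariant hG hF.differentiableAt hF.invariant hy
  rw [← form_grad hnd, hsymm.eq, hB, neg_eq_zero] at hzero
  exact hzero

/-- The directions in which `F` and `P` are compared are those of degree `≥ 0`, and the vectors
orthogonal to these have degree one. -/
lemma grad_sub_mem (hF : IsInvariantLift t deg h ψ F P x) (hB : B.lieInvariant g)
    (hnd : B.Nondegenerate) (hG : IsShortGrading h t deg) (hψ : ∀ u v, B (ψ u) (ψ v) = B u v) :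
    grad B t F x - ψ (grad B t P (t.equivFun (ψ.symm (total t x)))) ∈ degSpace ℝ h 1 := by
  refine mem_degSpace_of_form hB hnd.1 hG.basis_mem fun b hb => ?_
  have hconj : B (ψ (grad B t P (t.equivFun (ψ.symm (total t x))))) (t b) =
      fderiv ℝ P (t.equivFun (ψ.symm (total t x))) (t.equivFun (ψ.symm (t b))) := by
    rw [← form_grad hnd, ← hψ _ (ψ.symm (t b)), LieEquiv.apply_symm_apply]
  rw [map_sub, LinearMap.sub_apply, hconj, form_grad hnd, sub_eq_zero]
  have hFline := hF.differentiableAt.hasFDerivAt.hasLineDerivAt (t.equivFun (t b))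
  have hPline := hF.differentiableAt_base.hasFDerivAt.hasLineDerivAt (t.equivFun (ψ.symm (t b)))
  refine hFline.unique (HasDerivAt.congr_of_eventuallyEq hPline (.of_forall fun s => ?_))
  refine (hF.eq_comp _ ?_).trans ?_
  rotate_left
  · simp only [total_eq_equivFun_symm, map_add, map_smul, LinearEquiv.symm_apply_apply]
  · funext α
    have hαb : (α : ι) ≠ b := by
      rintro rfl
      have := α.2
      have := hG.neg_one_le α
      omega
    simp [negCoord, hαb]

lemma poisson_eq (hF : IsInvariantLift t deg h ψ F P x) (hH : IsInvariantLift t deg h ψ H Q x)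
    (hB : B.lieInvariant g) (hsymm : B.IsSymm) (hnd : B.Nondegenerate)
    (hG : IsShortGrading h t deg) (hψ : ∀ u v, B (ψ u) (ψ v) = B u v) :
    poisson B t F H x = poisson B t P Q (t.equivFun (ψ.symm (total t x))) := by
  have hFmem := hF.grad_sub_mem hB hnd hG hψ
  have hHmem := hH.grad_sub_mem hB hnd hG hψ
  have hFH := hF.form_lie_grad_eq_zero hB hsymm hnd hG hHmem
  have hHF := hH.form_lie_grad_eq_zero hB hsymm hnd hG hFmem
  have hlie := hG.lie_eq_zero hFmem hHmem
  rw [poisson_eq_form_lie_grad, poisson_eq_form_lie_grad, total_eq_equivFun_symm t (t.equivFun _),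
    LinearEquiv.symm_apply_apply, ← hψ (ψ.symm _), LieEquiv.apply_symm_apply, LieEquiv.map_lie]
  set p := ψ (grad B t P (t.equivFun (ψ.symm (total t x))))
  set q := ψ (grad B t Q (t.equivFun (ψ.symm (total t x))))
  have hpq : ⁅grad B t F x, grad B t H x⁆ = ⁅p, q⁆ + ⁅grad B t F x - p, grad B t H x⁆ -
      ⁅grad B t H x - q, grad B t F x⁆ - ⁅grad B t F x - p, grad B t H x - q⁆ := by
    rw [← lie_skew (grad B t H x - q) (grad B t F x)]
    simp only [lie_sub, sub_lie]
    abel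
  rw [hpq, hlie, map_sub, map_sub, map_add, hFH, hHF, map_zero, add_zero, sub_zero, sub_zero]

lemma poisson_coord_eq_zero (hF : IsInvariantLift t deg h ψ F P x) (hB : B.lieInvariant g)
    (hsymm : B.IsSymm) (hnd : B.Nondegenerate) (hG : IsShortGrading h t deg) (α : NegIdx deg) :
    poisson B t (fun z => z α) F x = 0 := by
  have hα : -deg α = 1 := by
    have := α.2
    have := hG.neg_one_le α
    omega
  rw [poisson_eq_form_lie_grad]
  exact hF.form_lie_grad_eq_zero hB hsymm hnd hG (hα ▸ grad_coord_mem hB hnd hG.basis_mem α)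

end IsInvariantLift

end Poisson

section PolynomialPoisson

variable {g ι : Type*} [LieRing g] [LieAlgebra ℝ g] [Fintype ι]
  {B : LinearMap.BilinForm ℝ g} {t : Module.Basis ι ℝ g} {deg : ι → ℤ} {h f X : g}

lemma hasFDerivAt_eval (P : MvPolynomial ι ℝ) (x : ι → ℝ) :
    HasFDerivAt (fun z => MvPolynomial.eval z P)
      (∑ a, MvPolynomial.eval x (MvPolynomial.pderiv a P) •
        (ContinuousLinearMap.proj a : (ι → ℝ) →L[ℝ] ℝ)) x := by
  classical
  induction P using MvPolynomial.induction_on with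
  | C r => simpa using hasFDerivAt_const r x
  | add p q hp hq =>
    simp only [map_add, add_smul, Finset.sum_add_distrib]
    exact hp.add hq
  | mul_X p b hp =>
    simp only [map_mul, MvPolynomial.eval_X]
    refine (hp.mul (hasFDerivAt_apply b x)).congr_fderiv ?_
    ext v
    simp [Derivation.leibniz, MvPolynomial.pderiv_X, Pi.single_apply, apply_ite, add_mul,
      Finset.sum_add_distrib, Finset.mul_sum, mul_assoc]

omit [Fintype ι] in
lemma fderiv_eval_single [Finite ι] [DecidableEq ι] (P : MvPolynomial ι ℝ) (x : ι → ℝ) (a : ι) :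
    fderiv ℝ (fun z => MvPolynomial.eval z P) x (Pi.single a 1) =
      MvPolynomial.eval x (MvPolynomial.pderiv a P) := by
  have := Fintype.ofFinite ι
  rw [(hasFDerivAt_eval P x).fderiv]
  simp [Pi.single_apply]

lemma eval_polyPoisson [DecidableEq ι] (P Q : MvPolynomial ι ℝ) (x : ι → ℝ) :
    MvPolynomial.eval x (polyPoisson B t P Q) =
      poisson B t (fun z => MvPolynomial.eval z P) (fun z => MvPolynomial.eval z Q) x := by
  simp only [polyPoisson, poisson, map_sum, map_mul, fderiv_eval_single, MvPolynomial.eval_C,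
    MvPolynomial.eval_X]

/-- A polynomial in the coordinates of degree `≥ 0`, as a function of all the coordinates. -/
noncomputable def nonnegEval (p : MvPolynomial (NonnegIdx deg) ℝ) (z : ι → ℝ) : ℝ :=
  MvPolynomial.eval (fun a : NonnegIdx deg => z a) p

omit [Fintype ι] in
lemma eval_imposeConstr (P : MvPolynomial ι ℝ) (u : NonnegIdx deg → ℝ) :
    MvPolynomial.eval u (imposeConstr t deg f P) =
      MvPolynomial.eval (constrPt t deg f u) P := by
  refine (MvPolynomial.comp_aeval_apply _ (MvPolynomial.aeval u) P).trans ?_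
  refine congrArg (MvPolynomial.eval · P) (funext fun a => ?_)
  rw [constrPt]
  split_ifs <;> simp

lemma contDiff_eval {ν : Type*} [Fintype ν] (p : MvPolynomial ν ℝ) :
    ContDiff ℝ ∞ fun u : ν → ℝ => MvPolynomial.eval u p :=
  contDiff_iff_contDiffAt.2 fun u =>
    (AnalyticOnNhd.eval_mvPolynomial p u (Set.mem_univ u)).contDiffAt

lemma contDiff_nonnegEval (p : MvPolynomial (NonnegIdx deg) ℝ) :
    ContDiff ℝ ∞ (nonnegEval p) :=
  (contDiff_eval p).comp (contDiff_pi.2 fun a => contDiff_apply ℝ ℝ a.1)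

namespace IsShortGrading

lemma eval_constrBracket [DecidableEq ι] (hG : IsShortGrading h t deg)
    (p q : MvPolynomial (NonnegIdx deg) ℝ) (hX : component t deg (-1) X = f) :
    MvPolynomial.eval (nonnegCoord t deg X) (constrBracket B t deg f p q) =
      poisson B t (nonnegEval p) (nonnegEval q) (t.equivFun X) := by
  have hpt : constrPt t deg f (nonnegCoord t deg X) = t.equivFun X := by
    rw [← equivFun_total t (constrPt t deg f _), hG.total_constrPt_nonnegCoord hX]
  rw [constrBracket, eval_imposeConstr, eval_polyPoisson, hpt]
  simp only [MvPolynomial.eval_rename]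
  rfl

lemma isInvariantLift_nonnegEval (hG : IsShortGrading h t deg) (hf : f ∈ degSpace ℝ h (-1))
    (p : wAlgebra t deg f) (hX : component t deg (-1) X = f) {y : g} (hy : y ∈ degSpace ℝ h 1) :
    IsInvariantLift t deg h (expAdEquiv (hG.isNilpotent_ad hy)).symm (nonnegEval p.1)
      (nonnegEval p.1) (t.equivFun X) where
  differentiableAt := (contDiff_nonnegEval p.1).differentiable (by simp) _
  differentiableAt_base := (contDiff_nonnegEval p.1).differentiable (by simp) _
  eq_comp z hz := by
    have hz' : component t deg (-1) (total t z) = f := by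
      rw [hG.component_neg_one_total, hz, ← hG.component_neg_one_total, total_eq_equivFun_symm,
        LinearEquiv.symm_apply_apply, hX]
    have hinv := (hG.mem_wAlgebra_iff hf).1 p.2 y hy _ hz'
    rw [← expAdEquiv_apply (hG.isNilpotent_ad hy)] at hinv
    rw [LieEquiv.symm_symm]
    refine Eq.trans ?_ hinv.symm
    conv_lhs => rw [← equivFun_total t z]
    rfl
  invariant z hz := by
    rw [total_eq_equivFun_symm, LinearEquiv.symm_apply_apply]
    exact (hG.mem_wAlgebra_iff hf).1 p.2 z hz X hX

lemma constrBracket_mem [DecidableEq ι] (hG : IsShortGrading h t deg) (hB : B.lieInvariant g)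
    (hsymm : B.IsSymm) (hnd : B.Nondegenerate) (hf : f ∈ degSpace ℝ h (-1))
    (p q : wAlgebra t deg f) : constrBracket B t deg f p q ∈ wAlgebra t deg f := by
  rw [hG.mem_wAlgebra_iff hf]
  intro y hy X hX
  have hX' : component t deg (-1) (expAd y X) = f := by rw [hG.component_neg_one_expAd hy, hX]
  have hψ := form_expAd hB (hG.isNilpotent_ad hy)
  have hpoisson := (hG.isInvariantLift_nonnegEval hf p hX hy).poisson_eq
    (hG.isInvariantLift_nonnegEval hf q hX hy) hB hsymm hnd hG fun u v => by
      rw [← hψ, ← expAdEquiv_apply (hG.isNilpotent_ad hy),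
        ← expAdEquiv_apply (hG.isNilpotent_ad hy), LieEquiv.apply_symm_apply,
        LieEquiv.apply_symm_apply]
  rw [hG.eval_constrBracket _ _ hX, hG.eval_constrBracket _ _ hX', hpoisson, total_eq_equivFun_symm,
    LinearEquiv.symm_apply_apply, LieEquiv.symm_symm, expAdEquiv_apply]

end IsShortGrading

end PolynomialPoisson

section OperatorExponential

open NormedSpace Topology

variable {E F G : Type*} [NormedAddCommGroup E] [NormedSpace ℝ E] [CompleteSpace E]
  [NormedAddCommGroup F] [NormedSpace ℝ F] [CompleteSpace F]
  [NormedAddCommGroup G] [NormedSpace ℝ G] [CompleteSpace G]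

lemma exp_neg_apply_exp_apply (D : E →L[ℝ] E) (x : E) : exp (-D) (exp D x) = x := by
  let _ : NormedAlgebra ℚ (E →L[ℝ] E) := NormedAlgebra.restrictScalars ℚ ℝ _
  rw [← mul_apply_eq_comp, ← exp_add_of_commute (Commute.refl D).neg_left, neg_add_cancel,
    exp_zero, one_apply_eq_self]

lemma hasDerivAt_exp_smul_apply (D : E →L[ℝ] E) (x : E) (s : ℝ) :
    HasDerivAt (fun s : ℝ => exp (s • D) x) (D (exp (s • D) x)) s :=
  ((hasDerivAt_exp_smul_const' (𝕂 := ℝ) D s).clm_apply (hasDerivAt_const s x)).congr_deriv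
    (by simp)

lemma exp_apply_bilinear (β : E →L[ℝ] F →L[ℝ] G) {D₁ : E →L[ℝ] E} {D₂ : F →L[ℝ] F}
    {D : G →L[ℝ] G} (hD : ∀ x y, D (β x y) = β (D₁ x) y + β x (D₂ y)) (x : E) (y : F) :
    exp D (β x y) = β (exp D₁ x) (exp D₂ y) := by
  have hderiv (s : ℝ) : HasDerivAt
      (fun s : ℝ => exp (s • -D) (β (exp (s • D₁) x) (exp (s • D₂) y))) 0 s := by
    refine ((hasDerivAt_exp_smul_const (𝕂 := ℝ) (-D) s).clm_apply (β.hasDerivAt_of_bilinear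
      (fun _ => hasDerivAt_exp_smul_apply D₁ x s)
      (fun _ => hasDerivAt_exp_smul_apply D₂ y s))).congr_deriv ?_
    simp only [mul_apply_eq_comp, neg_apply, map_neg, hD, map_add]
    abel
  have hconst := is_const_of_deriv_eq_zero (fun s => (hderiv s).differentiableAt)
    (fun s => (hderiv s).deriv) 1 0
  simp only [one_smul, zero_smul, exp_zero, one_apply_eq_self] at hconst
  rw [← hconst]
  simpa only [neg_neg] using exp_neg_apply_exp_apply (-D) (β (exp D₁ x) (exp D₂ y))

lemma exp_apply_eq_self {D : E →L[ℝ] E} {x : E} (hx : D x = 0) : exp D x = x := by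
  have hderiv (s : ℝ) : HasDerivAt (fun s : ℝ => exp (s • D) x) 0 s :=
    ((hasDerivAt_exp_smul_const (𝕂 := ℝ) D s).clm_apply (hasDerivAt_const s x)).congr_deriv
      (by simp [hx])
  simpa using is_const_of_deriv_eq_zero (fun s => (hderiv s).differentiableAt)
    (fun s => (hderiv s).deriv) 1 0

lemma contDiff_exp : ContDiff ℝ ω (exp : (E →L[ℝ] E) → E →L[ℝ] E) :=
  contDiff_iff_contDiffAt.2 fun x => (exp_analytic x).contDiffAt

lemma exists_contDiffAt_exp_apply_eq {D : E →L[ℝ] F →L[ℝ] F} {π : F →L[ℝ] E} {x : F}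
    (hD : ∀ v, π (D v x) = v) :
    ∃ v : E → E, ∀ᶠ c in 𝓝 (π x), ContDiffAt ℝ ∞ v c ∧ π (exp (D (v c)) x) = c := by
  let Θ : E → E := fun v => π (exp (D v) x)
  have hΘ : ContDiffAt ℝ ω Θ 0 := ContDiff.contDiffAt
    (π.contDiff.comp ((contDiff_exp.comp D.contDiff).clm_apply contDiff_const))
  have hderiv : HasFDerivAt Θ (ContinuousLinearEquiv.refl ℝ E : E →L[ℝ] E) 0 := by
    have hexp : HasFDerivAt (exp : (F →L[ℝ] F) → F →L[ℝ] F)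
        (1 : (F →L[ℝ] F) →L[ℝ] F →L[ℝ] F) (D 0) := by
      rw [map_zero]
      exact hasFDerivAt_exp_zero
    refine (π.hasFDerivAt.comp 0 ((hexp.comp 0 D.hasFDerivAt).clm_apply
      (hasFDerivAt_const x 0))).congr_fderiv (ContinuousLinearMap.ext fun v => ?_)
    simpa using hD v
  have hω : (ω : WithTop ℕ∞) ≠ 0 := by simp
  have hsmooth := (hΘ.to_localInverse hderiv hω).eventually (by simp)
  have hsection := (hΘ.hasStrictFDerivAt' hderiv hω).eventually_right_inverse
  have hΘ0 : Θ 0 = π x := by simp only [Θ, map_zero, exp_zero, one_apply_eq_self]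
  rw [hΘ0] at hsmooth hsection
  exact ⟨_, (hsmooth.and hsection).mono fun c hc => ⟨hc.1.of_le le_top, hc.2⟩⟩

end OperatorExponential

section ExpAut

variable {g ι : Type*} [LieRing g] [LieAlgebra ℝ g] [Fintype ι]
  {B : LinearMap.BilinForm ℝ g} {t : Module.Basis ι ℝ g} {x : g}

/-- A linear endomorphism, written in the coordinates of a basis. -/
noncomputable def coordMap (t : Module.Basis ι ℝ g) :
    (g →ₗ[ℝ] g) →ₗ[ℝ] (ι → ℝ) →L[ℝ] (ι → ℝ) :=
  (LinearMap.toContinuousLinearMap : ((ι → ℝ) →ₗ[ℝ] ι → ℝ) ≃ₗ[ℝ] _).toLinearMap ∘ₗ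
    (t.equivFun.conj : (g →ₗ[ℝ] g) ≃ₗ[ℝ] _).toLinearMap

lemma coordMap_apply (T : g →ₗ[ℝ] g) (x : ι → ℝ) :
    coordMap t T x = t.equivFun (T (t.equivFun.symm x)) := rfl

/-- The exponential of a linear endomorphism, computed in the coordinates of a basis since `g`
carries no norm. -/
noncomputable def expEnd (t : Module.Basis ι ℝ g) (T : g →ₗ[ℝ] g) : g →ₗ[ℝ] g :=
  t.equivFun.symm.toLinearMap ∘ₗ (NormedSpace.exp (coordMap t T)).toLinearMap ∘ₗ
    t.equivFun.toLinearMap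

lemma expEnd_apply (T : g →ₗ[ℝ] g) (x : g) :
    expEnd t T x = t.equivFun.symm (NormedSpace.exp (coordMap t T) (t.equivFun x)) := rfl

lemma coordMap_expEnd (T : g →ₗ[ℝ] g) :
    coordMap t (expEnd t T) = NormedSpace.exp (coordMap t T) :=
  ContinuousLinearMap.ext fun x => by
    rw [coordMap_apply, expEnd_apply, LinearEquiv.apply_symm_apply, LinearEquiv.apply_symm_apply]

lemma expEnd_neg_apply (T : g →ₗ[ℝ] g) (x : g) : expEnd t (-T) (expEnd t T x) = x := by
  rw [expEnd_apply, expEnd_apply, LinearEquiv.apply_symm_apply, map_neg,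
    exp_neg_apply_exp_apply, LinearEquiv.symm_apply_apply]

lemma expEnd_eq_self {T : g →ₗ[ℝ] g} (hx : T x = 0) : expEnd t T x = x := by
  rw [expEnd_apply, exp_apply_eq_self, LinearEquiv.symm_apply_apply]
  rw [coordMap_apply, LinearEquiv.symm_apply_apply, hx, map_zero]

lemma exp_apply_bilinear_expEnd {G : Type*} [NormedAddCommGroup G] [NormedSpace ℝ G]
    [CompleteSpace G] (β : g →ₗ[ℝ] g →ₗ[ℝ] G) {T : g →ₗ[ℝ] g} {D : G →L[ℝ] G}
    (hD : ∀ x y, D (β x y) = β (T x) y + β x (T y)) (x y : g) :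
    NormedSpace.exp D (β x y) = β (expEnd t T x) (expEnd t T y) := by
  let β' : (ι → ℝ) →L[ℝ] (ι → ℝ) →L[ℝ] G := (β.compl₁₂ t.equivFun.symm.toLinearMap
    t.equivFun.symm.toLinearMap).toContinuousBilinearMap
  have hβ' (u v : ι → ℝ) : β' u v = β (t.equivFun.symm u) (t.equivFun.symm v) := rfl
  have hexp := exp_apply_bilinear β' (D := D) (D₁ := coordMap t T) (D₂ := coordMap t T)
    (fun u v => by simp only [hβ', coordMap_apply, LinearEquiv.symm_apply_apply, hD])
    (t.equivFun x) (t.equivFun y)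
  simpa only [hβ', ← expEnd_apply, LinearEquiv.symm_apply_apply] using hexp

lemma expEnd_lie (D : LieDerivation ℝ g g) (x y : g) :
    expEnd t D.toLinearMap ⁅x, y⁆ = ⁅expEnd t D.toLinearMap x, expEnd t D.toLinearMap y⁆ := by
  have hexp := exp_apply_bilinear_expEnd (t := t) (T := D.toLinearMap)
    (D := coordMap t D.toLinearMap)
    ((LieModule.toEnd ℝ g g : g →ₗ[ℝ] g →ₗ[ℝ] g).compr₂ t.equivFun.toLinearMap) (fun u v => by
      change t.equivFun (D.toLinearMap (t.equivFun.symm (t.equivFun ⁅u, v⁆))) =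
        t.equivFun ⁅D u, v⁆ + t.equivFun ⁅u, D v⁆
      rw [LinearEquiv.symm_apply_apply, ← map_add, ← lie_skew (D u) v, neg_add_eq_sub]
      exact congrArg t.equivFun (D.leibniz' u v)) x y
  refine t.equivFun.injective (Eq.trans ?_ hexp)
  rw [expEnd_apply, LinearEquiv.apply_symm_apply]
  rfl

/-- The automorphism `exp D` of a Lie algebra with a derivation `D`. -/
noncomputable def expAut (t : Module.Basis ι ℝ g) (D : LieDerivation ℝ g g) : g ≃ₗ⁅ℝ⁆ g where
  __ := expEnd t D.toLinearMap
  map_lie' := expEnd_lie D _ _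
  invFun := expEnd t (-D.toLinearMap)
  left_inv := expEnd_neg_apply D.toLinearMap
  right_inv x := (congrArg (fun T => expEnd t T _) (neg_neg D.toLinearMap).symm).trans
    (expEnd_neg_apply (-D.toLinearMap) x)

lemma form_expEnd {T : g →ₗ[ℝ] g} (hT : ∀ x y, B (T x) y + B x (T y) = 0) (x y : g) :
    B (expEnd t T x) (expEnd t T y) = B x y := by
  simpa using (exp_apply_bilinear_expEnd B (D := 0) (fun u v => by simp [hT]) x y).symm

end ExpAut

section GradedConjugation

open Topology

variable {g ι : Type*} [LieRing g] [LieAlgebra ℝ g] [Fintype ι]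
  {B : LinearMap.BilinForm ℝ g} {t : Module.Basis ι ℝ g} {deg : ι → ℤ} {h e f x : g}
  {c c' : NegIdx deg → ℝ} {k : ℤ} {ψ : g ≃ₗ⁅ℝ⁆ g}

lemma expAut_apply (D : LieDerivation ℝ g g) (x : g) : expAut t D x =
    total t (NormedSpace.exp (coordMap t D.toLinearMap) (t.equivFun x)) :=
  (total_eq_equivFun_symm t _).symm

lemma coordMap_trans_expAut_symm (ψ : g ≃ₗ⁅ℝ⁆ g) (D : LieDerivation ℝ g g) :
    coordMap t ((ψ.trans (expAut t D)).symm : g →ₗ⁅ℝ⁆ g) =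
      (coordMap t (ψ.symm : g →ₗ⁅ℝ⁆ g)).comp (NormedSpace.exp (-coordMap t D.toLinearMap)) := by
  rw [← map_neg, ← coordMap_expEnd]
  refine ContinuousLinearMap.ext fun x => ?_
  rw [ContinuousLinearMap.comp_apply, coordMap_apply, coordMap_apply, coordMap_apply,
    LinearEquiv.symm_apply_apply]
  rfl

lemma negElt_mem_degSpace (hG : IsShortGrading h t deg) (c : NegIdx deg → ℝ) :
    negElt t deg c ∈ degSpace ℝ h (-1) :=
  sum_mem fun α _ => Submodule.smul_mem _ _ (by
    have hα : deg α = -1 := le_antisymm (by have := α.2; omega) (hG.neg_one_le α)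
    exact hα ▸ hG.basis_mem α)

namespace IsGradedConj

lemma map_triple (hψ : IsGradedConj B t deg h f c ψ) (htriple : IsSl2Triple h e f) :
    IsSl2Triple h (ψ e) (negElt t deg c) where
  h_ne_zero := htriple.h_ne_zero
  lie_e_f := by rw [← hψ.map_f, ← LieEquiv.map_lie, htriple.lie_e_f, hψ.map_h]
  lie_h_e_nsmul := by
    conv_lhs => rw [← hψ.map_h, ← LieEquiv.map_lie, htriple.lie_h_e_nsmul, map_nsmul]
  lie_h_f_nsmul := by
    conv_lhs => rw [← hψ.map_f, ← hψ.map_h, ← LieEquiv.map_lie, htriple.lie_h_f_nsmul, map_neg,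
      map_nsmul, hψ.map_f]

lemma map_mem_degSpace (hψ : IsGradedConj B t deg h f c ψ) (hx : x ∈ degSpace ℝ h k) :
    ψ x ∈ degSpace ℝ h k := by
  rw [mem_degSpace]
  conv_lhs => rw [← hψ.map_h, ← LieEquiv.map_lie, mem_degSpace.1 hx, map_smul]

lemma symm_mem_degSpace (hψ : IsGradedConj B t deg h f c ψ) (hx : x ∈ degSpace ℝ h k) :
    ψ.symm x ∈ degSpace ℝ h k := by
  have hh : ψ.symm h = h := by
    conv_lhs => rw [← hψ.map_h]
    exact ψ.symm_apply_apply h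
  rw [mem_degSpace]
  conv_lhs => rw [← hh, ← LieEquiv.map_lie, mem_degSpace.1 hx, map_smul]

lemma trans_expAut (hψ : IsGradedConj B t deg h f c ψ) {D : LieDerivation ℝ g g} (hDh : D h = 0)
    (hDB : ∀ x y, B (D x) y + B x (D y) = 0)
    (hDc : expAut t D (negElt t deg c) = negElt t deg c') :
    IsGradedConj B t deg h f c' (ψ.trans (expAut t D)) where
  map_h := by
    rw [LieEquiv.trans_apply, hψ.map_h]
    exact expEnd_eq_self hDh
  map_form x y := (form_expEnd hDB _ _).trans (hψ.map_form x y)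
  map_f := by rw [LieEquiv.trans_apply, hψ.map_f, hDc]

end IsGradedConj

/-- The element of degree zero whose adjoint action moves `negElt t deg c`, the lowering element
of a triple with raising element `e`, in the direction `v`. -/
noncomputable def tangentElt (t : Module.Basis ι ℝ g) (deg : ι → ℤ) (e : g) :
    (NegIdx deg → ℝ) →ₗ[ℝ] g :=
  (-2⁻¹ : ℝ) • (LieAlgebra.ad ℝ g e : g →ₗ[ℝ] g) ∘ₗ
    Fintype.linearCombination ℝ fun α : NegIdx deg => t α

lemma tangentElt_apply (e : g) (v : NegIdx deg → ℝ) :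
    tangentElt t deg e v = (-2⁻¹ : ℝ) • ⁅e, negElt t deg v⁆ := rfl

namespace IsShortGrading

lemma lie_tangentElt_h (hG : IsShortGrading h t deg) (he : e ∈ degSpace ℝ h 1)
    (v : NegIdx deg → ℝ) : ⁅tangentElt t deg e v, h⁆ = 0 := by
  have hmem : tangentElt t deg e v ∈ degSpace ℝ h (1 + -1) :=
    Submodule.smul_mem _ _ (lie_mem_degSpace he (negElt_mem_degSpace hG v))
  rw [← lie_skew, mem_degSpace.1 hmem]
  simp

lemma lie_tangentElt_negElt (hG : IsShortGrading h t deg)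
    (htriple : IsSl2Triple h e (negElt t deg c)) (v : NegIdx deg → ℝ) :
    ⁅tangentElt t deg e v, negElt t deg c⁆ = negElt t deg v := by
  rw [tangentElt_apply, smul_lie, lie_lie,
    hG.lie_eq_zero_of_neg (negElt_mem_degSpace hG v) (negElt_mem_degSpace hG c), lie_zero,
    zero_sub, htriple.lie_e_f, lie_skew, mem_degSpace.1 (negElt_mem_degSpace hG v), smul_smul]
  norm_num

lemma expAut_negElt (hG : IsShortGrading h t deg) {D : LieDerivation ℝ g g} (hDh : D h = 0)
    (c : NegIdx deg → ℝ) :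
    expAut t D (negElt t deg c) = negElt t deg (negCoord deg
      (NormedSpace.exp (coordMap t D.toLinearMap) (t.equivFun (negElt t deg c)))) := by
  have hh : expAut t D h = h := expEnd_eq_self hDh
  have hmem : expAut t D (negElt t deg c) ∈ degSpace ℝ h (-1) := by
    rw [mem_degSpace]
    conv_lhs => rw [← hh, ← LieEquiv.map_lie, mem_degSpace.1 (negElt_mem_degSpace hG c), map_smul]
  rw [← component_of_mem hG.basis_mem hmem, expAut_apply, hG.component_neg_one_total]

end IsShortGrading

theorem exists_contDiffAt_isGradedConj (hG : IsShortGrading h t deg) (hB : B.lieInvariant g)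
    (htriple : IsSl2Triple h e f) (hc : c ∈ regularSet B t deg h f) :
    ∃ ψ : (NegIdx deg → ℝ) → g ≃ₗ⁅ℝ⁆ g, ∀ᶠ c' in 𝓝 c, IsGradedConj B t deg h f c' (ψ c') ∧
      ContDiffAt ℝ ∞ (fun c => coordMap t ((ψ c).symm : g →ₗ⁅ℝ⁆ g)) c' := by
  obtain ⟨φ, hφ⟩ := hc
  have hφtriple := hφ.map_triple htriple
  let D (v : NegIdx deg → ℝ) : LieDerivation ℝ g g :=
    LieDerivation.ad ℝ g (tangentElt t deg (φ e) v)
  let Dcoord : (NegIdx deg → ℝ) →L[ℝ] (ι → ℝ) →L[ℝ] ι → ℝ := LinearMap.toContinuousLinearMap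
    (coordMap t ∘ₗ (LieAlgebra.ad ℝ g : g →ₗ[ℝ] g →ₗ[ℝ] g) ∘ₗ tangentElt t deg (φ e))
  let π : (ι → ℝ) →L[ℝ] NegIdx deg → ℝ :=
    ContinuousLinearMap.pi fun α => ContinuousLinearMap.proj (α : ι)
  have hDh (v) : D v h = 0 :=
    (LieDerivation.ad_apply_apply ℝ g _ _).trans (hG.lie_tangentElt_h (e_mem_degSpace hφtriple) v)
  have hcoord (v) : coordMap t (D v).toLinearMap = Dcoord v :=
    congrArg (coordMap t) (LinearMap.ext fun x => LieDerivation.ad_apply_apply ℝ g _ _)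
  have hDB (v) (x y : g) : B (D v x) y + B x (D v y) = 0 := by
    simp [D, hB _ x y]
  have hπ (v : NegIdx deg → ℝ) : π (Dcoord v (t.equivFun (negElt t deg c))) = v := by
    refine Eq.trans (congrArg (negCoord deg) ?_) (negCoord_equivFun_negElt (t := t) v)
    rw [← hG.lie_tangentElt_negElt hφtriple v]
    exact congrArg t.equivFun
      (congrArg (LieAlgebra.ad ℝ g (tangentElt t deg (φ e) v)) (t.equivFun.symm_apply_apply _))
  obtain ⟨v, hv⟩ := exists_contDiffAt_exp_apply_eq hπ
  have hc : π (t.equivFun (negElt t deg c)) = c := negCoord_equivFun_negElt c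
  rw [hc] at hv
  refine ⟨fun c' => φ.trans (expAut t (D (v c'))), hv.mono fun c' hc' =>
    ⟨hφ.trans_expAut (hDh _) (hDB _) ?_, ?_⟩⟩
  · rw [hG.expAut_negElt (hDh _), hcoord]
    exact congrArg (negElt t deg) hc'.2
  · simp only [coordMap_trans_expAut_symm, hcoord]
    exact contDiffAt_const.clm_comp ((contDiff_exp.of_le le_top).contDiffAt.comp c'
      (Dcoord.contDiff.contDiffAt.comp c' hc'.1).neg)

end GradedConjugation

section Transport

variable {g ι κ : Type*} [LieRing g] [LieAlgebra ℝ g] [Fintype ι]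
  {B : LinearMap.BilinForm ℝ g} {t : Module.Basis ι ℝ g} {deg : ι → ℤ} {h e f X y : g}
  {c : NegIdx deg → ℝ} {U : Set (NegIdx deg → ℝ)} {x : ι → ℝ} {ψ : g ≃ₗ⁅ℝ⁆ g} {σ : κ → ℤ}
  {ℓ : κ → g} {W : κ → wAlgebra t deg f} {What : κ → (ι → ℝ) → ℝ}

namespace IsShortGrading

lemma negCoord_eq_of_component_eq (hG : IsShortGrading h t deg)
    (hX : component t deg (-1) X = negElt t deg c) : negCoord deg (t.equivFun X) = c := by
  have hneg := hG.component_neg_one_total (t.equivFun X)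
  rw [total_eq_equivFun_symm, LinearEquiv.symm_apply_apply, hX] at hneg
  rw [← negCoord_equivFun_negElt (t := t) c, hneg, negCoord_equivFun_negElt]

lemma negCoord_expAd (hG : IsShortGrading h t deg) (hy : y ∈ degSpace ℝ h 1) (x : ι → ℝ) :
    negCoord deg (t.equivFun (expAd y (total t x))) = negCoord deg x :=
  hG.negCoord_eq_of_component_eq (by rw [hG.component_neg_one_expAd hy, hG.component_neg_one_total])

end IsShortGrading

namespace IsGradedConj

lemma component_neg_one_symm (hψ : IsGradedConj B t deg h f c ψ) (hG : IsShortGrading h t deg)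
    (hx : negCoord deg x = c) : component t deg (-1) (ψ.symm (total t x)) = f := by
  have hmap := component_map (φ := (ψ.symm : g →ₗ⁅ℝ⁆ g)) (j := 0) hG.basis_mem
    (fun i z hz => (add_zero i).symm ▸ hψ.symm_mem_degSpace hz) (-1) (total t x)
  refine hmap.trans ?_
  rw [hG.component_neg_one_total, hx, ← hψ.map_f]
  exact ψ.symm_apply_apply f

lemma negCoord_map (hψ : IsGradedConj B t deg h f c ψ) (hG : IsShortGrading h t deg)
    (hX : component t deg (-1) X = f) : negCoord deg (t.equivFun (ψ X)) = c := by
  have hmap := component_map (φ := (ψ : g →ₗ⁅ℝ⁆ g)) (j := 0) hG.basis_mem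
    (fun i z hz => (add_zero i).symm ▸ hψ.map_mem_degSpace hz) (-1) X
  refine hG.negCoord_eq_of_component_eq (hmap.trans ?_)
  rw [hX]
  exact hψ.map_f

lemma symm_expAd (hψ : IsGradedConj B t deg h f c ψ) (hG : IsShortGrading h t deg)
    (hy : y ∈ degSpace ℝ h 1) (X : g) : ψ.symm (expAd y X) = expAd (ψ.symm y) (ψ.symm X) := by
  rw [hG.expAd_eq hy, hG.expAd_eq (hψ.symm_mem_degSpace hy)]
  simp only [map_add, map_smul, LieEquiv.map_lie]

end IsGradedConj

/-- Over the point `c` the functions `What` are the generators `W` of the W-algebra, transported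
from the constraint surface by the automorphism `ψ`, which sends `t^-` to `J_α t^α` with
`J_α = c_α`. -/
structure IsTransport (B : LinearMap.BilinForm ℝ g) (t : Module.Basis ι ℝ g) (deg : ι → ℤ)
    (h : g) {f : g} (W : κ → wAlgebra t deg f) (What : κ → (ι → ℝ) → ℝ) (c : NegIdx deg → ℝ)
    (ψ : g ≃ₗ⁅ℝ⁆ g) : Prop extends IsGradedConj B t deg h f c ψ where
  eq_eval : ∀ x, negCoord deg x = c → ∀ s,
    What s x = MvPolynomial.eval (nonnegCoord t deg (ψ.symm (total t x))) (W s).1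

variable [Fintype κ]

/-- The homomorphism of the W-algebra to functions of the coordinates with values `What` on the
generators: an element of the W-algebra is determined by its restriction to `t^- + w_s ℓ^s`, in
which the functions `What` are substituted for the `w_s`. -/
noncomputable def substHom (t : Module.Basis ι ℝ g) (deg : ι → ℤ) (f : g) (ℓ : κ → g)
    (What : κ → (ι → ℝ) → ℝ) : wAlgebra t deg f →ₐ[ℝ] (ι → ℝ) → ℝ :=
  ((MvPolynomial.aeval What).comp (sliceRestriction t deg f ℓ)).comp (wAlgebra t deg f).val

lemma substHom_apply (p : wAlgebra t deg f) (x : ι → ℝ) :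
    substHom t deg f ℓ What p x =
      MvPolynomial.eval (fun s => What s x) (sliceRestriction t deg f ℓ p.1) :=
  MvPolynomial.comp_aeval_apply What (Pi.evalAlgHom ℝ (fun _ : ι → ℝ => ℝ) x) _

lemma substHom_generator (hW : IsGaugeGenerators t deg f ℓ W) (hG : IsShortGrading h t deg)
    (htriple : IsSl2Triple h e f) (hℓ : IsHighestWeightBasis h e σ ℓ) (s : κ) :
    substHom t deg f ℓ What (W s) = What s := by
  funext x
  rw [substHom_apply, hW.sliceRestriction_apply hG htriple hℓ, MvPolynomial.eval_X]

lemma differentiableAt_substHom (hWhat : ∀ s, DifferentiableAt ℝ (What s) x)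
    (p : wAlgebra t deg f) : DifferentiableAt ℝ (substHom t deg f ℓ What p) x := by
  simp only [funext (substHom_apply p)]
  exact ((contDiff_eval _).differentiable (by simp) _).comp x (differentiableAt_pi.2 hWhat)

namespace IsTransport

lemma substHom_eq (hT : IsTransport B t deg h W What c ψ) (hW : IsGaugeGenerators t deg f ℓ W)
    (hG : IsShortGrading h t deg) (p : wAlgebra t deg f) (hx : negCoord deg x = c) :
    substHom t deg f ℓ What p x = nonnegEval p.1 (t.equivFun (ψ.symm (total t x))) := by
  rw [substHom_apply]
  simp only [hT.eq_eval x hx]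
  exact (hW.eval_eq_eval_slice hG p (hT.component_neg_one_symm hG hx)).symm

lemma isInvariantLift_substHom (hT : IsTransport B t deg h W What (negCoord deg x) ψ)
    (hW : IsGaugeGenerators t deg f ℓ W) (hG : IsShortGrading h t deg)
    (hf : f ∈ degSpace ℝ h (-1)) (hWhat : ∀ s, DifferentiableAt ℝ (What s) x)
    (p : wAlgebra t deg f) :
    IsInvariantLift t deg h ψ (substHom t deg f ℓ What p) (nonnegEval p.1) x where
  differentiableAt := differentiableAt_substHom hWhat p
  differentiableAt_base := (contDiff_nonnegEval p.1).differentiable (by simp) _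
  eq_comp _ hz := hT.substHom_eq hW hG p hz
  invariant y hy := by
    rw [hT.substHom_eq hW hG p rfl, hT.substHom_eq hW hG p (hG.negCoord_expAd hy x),
      total_eq_equivFun_symm t (t.equivFun _), LinearEquiv.symm_apply_apply,
      hT.symm_expAd hG hy]
    exact (hG.mem_wAlgebra_iff hf).1 p.2 _ (hT.symm_mem_degSpace hy) _
      (hT.component_neg_one_symm hG rfl)

lemma eq_zero_of_substHom_eq_zero (hT : IsTransport B t deg h W What c ψ)
    (hW : IsGaugeGenerators t deg f ℓ W) (hG : IsShortGrading h t deg)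
    (hf : f ∈ degSpace ℝ h (-1)) {p : wAlgebra t deg f}
    (hp : ∀ x, negCoord deg x = c → substHom t deg f ℓ What p x = 0) : p = 0 := by
  refine Subtype.ext (MvPolynomial.funext fun u => ?_)
  have hX := hG.component_neg_one_total_constrPt hf u
  have hc := hT.negCoord_map hG hX
  have hzero := hp _ hc
  rw [hT.substHom_eq hW hG p hc, total_eq_equivFun_symm t (t.equivFun _),
    LinearEquiv.symm_apply_apply, LieEquiv.symm_apply_apply] at hzero
  rw [← nonnegCoord_total_constrPt (t := t) (f := f) u]
  exact hzero.trans (map_zero _).symm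

end IsTransport

theorem formWAlgebra_of_isTransport [DecidableEq ι] (hG : IsShortGrading h t deg)
    (hB : B.lieInvariant g) (hsymm : B.IsSymm) (hnd : B.Nondegenerate)
    (htriple : IsSl2Triple h e f) (hℓ : IsHighestWeightBasis h e σ ℓ)
    (hW : IsGaugeGenerators t deg f ℓ W) (hU : U.Nonempty)
    (hWhat : ∀ s x, negCoord deg x ∈ U → ContDiffAt ℝ ∞ (What s) x)
    (hT : ∀ c ∈ U, ∃ ψ, IsTransport B t deg h W What c ψ) :
    FormWAlgebra B t deg f U W What := by
  have hf : f ∈ degSpace ℝ h (-1) := f_mem_degSpace htriple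
  have hgen (s) : substHom t deg f ℓ What (W s) = What s := substHom_generator hW hG htriple hℓ s
  have hlift {x : ι → ℝ} (hx : negCoord deg x ∈ U) {ψ : g ≃ₗ⁅ℝ⁆ g}
      (hψ : IsTransport B t deg h W What (negCoord deg x) ψ) (p : wAlgebra t deg f) :
      IsInvariantLift t deg h ψ (substHom t deg f ℓ What p) (nonnegEval p.1) x :=
    hψ.isInvariantLift_substHom hW hG hf (fun s => (hWhat s x hx).differentiableAt (by simp)) p
  refine ⟨fun s x hx => (hWhat s x hx).contDiffWithinAt, fun α s x hx => ?_,
    substHom t deg f ℓ What, hgen, fun p hp => ?_, fun p q r hr x hx => ?_⟩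
  · obtain ⟨ψ, hψ⟩ := hT _ hx
    exact hgen s ▸ (hlift hx hψ (W s)).poisson_coord_eq_zero hB hsymm hnd hG α
  · obtain ⟨c, hc⟩ := hU
    obtain ⟨ψ, hψ⟩ := hT c hc
    exact hψ.eq_zero_of_substHom_eq_zero hW hG hf fun x hx => hp x (hx ▸ hc)
  · obtain ⟨ψ, hψ⟩ := hT _ hx
    rw [(hlift hx hψ p).poisson_eq (hlift hx hψ q) hB hsymm hnd hG hψ.map_form,
      hψ.substHom_eq hW hG r rfl, hr,
      ← hG.eval_constrBracket p.1 q.1 (hψ.component_neg_one_symm hG rfl)]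
    rfl

end Transport

section MatrixSmoothness

variable {𝕜 E κ : Type*} [NontriviallyNormedField 𝕜] [NormedAddCommGroup E] [NormedSpace 𝕜 E]
  [Fintype κ] [DecidableEq κ] {M : E → Matrix κ κ 𝕜} {c : E} {n : WithTop ℕ∞}

lemma contDiffAt_det (hM : ∀ s r, ContDiffAt 𝕜 n (fun x => M x s r) c) :
    ContDiffAt 𝕜 n (fun x => (M x).det) c := by
  simp only [Matrix.det_apply']
  exact ContDiffAt.sum fun τ _ => contDiffAt_const.mul (contDiffAt_prod fun i _ => hM _ _)

lemma contDiffAt_matrix_inv [CompleteSpace 𝕜] (hM : ∀ s r, ContDiffAt 𝕜 n (fun x => M x s r) c)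
    (hu : IsUnit (M c)) (s r : κ) : ContDiffAt 𝕜 n (fun x => (M x)⁻¹ s r) c := by
  simp only [Matrix.inv_def, Matrix.smul_apply, smul_eq_mul, Ring.inverse_eq_inv',
    Matrix.adjugate_apply]
  refine ((contDiffAt_det hM).inv ((Matrix.isUnit_iff_isUnit_det _).1 hu).ne_zero).mul
    (contDiffAt_det fun i j => ?_)
  simp only [Matrix.updateRow_apply]
  split_ifs
  exacts [contDiffAt_const, hM i j]

end MatrixSmoothness

section Transition

open Topology

variable {g ι κ : Type*} [LieRing g] [LieAlgebra ℝ g] [Fintype ι] [Fintype κ]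
  {B : LinearMap.BilinForm ℝ g} {t : Module.Basis ι ℝ g} {deg : ι → ℤ} {h e f : g}
  {c : NegIdx deg → ℝ} {V : Set (NegIdx deg → ℝ)} {x : ι → ℝ} {ψ : g ≃ₗ⁅ℝ⁆ g} {σ : κ → ℤ}
  {ℓ : κ → g} {ℓt : κ → (NegIdx deg → ℝ) → g} {W : κ → wAlgebra t deg f} {M : Matrix κ κ ℝ}
  {F : (NegIdx deg → ℝ) → Matrix κ κ ℝ}

/-- The automorphism `ψ` sends `t^-` to `J_α t^α` with `J_α = c_α`, and `M` expresses the highest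
weight vectors over `c`, conjugated back by `ψ`, in terms of the fixed ones. -/
structure IsTransition (B : LinearMap.BilinForm ℝ g) (t : Module.Basis ι ℝ g) (deg : ι → ℤ)
    (h f : g) (ℓ : κ → g) (ℓt : κ → (NegIdx deg → ℝ) → g) (c : NegIdx deg → ℝ)
    (ψ : g ≃ₗ⁅ℝ⁆ g) (M : Matrix κ κ ℝ) : Prop extends IsGradedConj B t deg h f c ψ where
  symm_eq_sum : ∀ r, ψ.symm (ℓt r c) = ∑ s, M s r • ℓ s

omit [Fintype κ] in
lemma IsGradedConj.symm_mem_span (hψ : IsGradedConj B t deg h f c ψ)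
    (hG : IsShortGrading h t deg) (htriple : IsSl2Triple h e f)
    (hℓ : IsHighestWeightBasis h e σ ℓ) (hℓt : IsHighestWeightFrame t deg h σ V ℓt) (hc : c ∈ V)
    (r : κ) : ψ.symm (ℓt r c) ∈ Submodule.span ℝ (Set.range ℓ) := by
  obtain ⟨e', htriple', hbasis⟩ := hℓt.basis c hc
  obtain rfl : e' = ψ e := hG.e_unique (hψ.map_triple htriple) htriple'
  have hlie := hbasis.mem_span_iff.1 (Submodule.subset_span (Set.mem_range_self r))
  rw [hℓ.mem_span_iff, ← ψ.symm_apply_apply e, ← LieEquiv.map_lie, hlie, map_zero]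

lemma exists_isHighestWeightForm_wTilde
    (hx : ∃ w : κ → ℝ, ∃ y ∈ gPlus t deg, IsHighestWeightForm t deg ℓt x y w) :
    ∃ y ∈ gPlus t deg, IsHighestWeightForm t deg ℓt x y fun s => wTilde t deg ℓt s x := by
  simpa only [wTilde, dif_pos hx] using hx.choose_spec

namespace IsTransition

lemma isUnit [DecidableEq κ] (hψ : IsTransition B t deg h f ℓ ℓt c ψ M)
    (hℓt : LinearIndependent ℝ fun s => ℓt s c) : IsUnit M := by
  rw [← Matrix.mulVec_injective_iff_isUnit]
  refine (injective_iff_map_eq_zero M.mulVecLin).2 fun v hv => ?_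
  refine funext (Fintype.linearIndependent_iff.1 hℓt v (ψ.symm.injective ?_))
  calc ψ.symm (∑ r, v r • ℓt r c) = ∑ r, ∑ s, (M s r * v r) • ℓ s := by
        simp only [map_sum, map_smul, hψ.symm_eq_sum, Finset.smul_sum, smul_smul, mul_comm]
    _ = ∑ s, (M.mulVecLin v) s • ℓ s := by
        rw [Finset.sum_comm]
        simp only [← Finset.sum_smul]
        rfl
    _ = ψ.symm 0 := by simp [hv]

lemma apply_eq_zero (hψ : IsTransition B t deg h f ℓ ℓt c ψ M)
    (hℓ : IsHighestWeightBasis h e σ ℓ) (hℓt : ∀ s, ⁅h, ℓt s c⁆ = (2 * (σ s : ℝ)) • ℓt s c)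
    {s r : κ} (hsr : σ s ≠ σ r) : M s r = 0 := by
  have hlie : ⁅h, ψ.symm (ℓt r c)⁆ = (2 * (σ r : ℝ)) • ψ.symm (ℓt r c) :=
    mem_degSpace.1 (hψ.symm_mem_degSpace (mem_degSpace.2 (hℓt r)))
  rw [hψ.symm_eq_sum, lie_sum, Finset.smul_sum, ← sub_eq_zero, ← Finset.sum_sub_distrib] at hlie
  simp only [lie_smul, hℓ.weight, smul_smul, ← sub_smul] at hlie
  have hcoeff := Fintype.linearIndependent_iff.1 hℓ.linearIndependent _ hlie s
  have hmul : ((σ s : ℝ) - σ r) * M s r = 0 := by linarith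
  exact (mul_eq_zero.1 hmul).resolve_left (sub_ne_zero.2 (mod_cast hsr))

lemma eval_eq_sum (hψ : IsTransition B t deg h f ℓ ℓt (negCoord deg x) ψ M)
    (hW : IsGaugeGenerators t deg f ℓ W) (hG : IsShortGrading h t deg)
    (htriple : IsSl2Triple h e f) (hℓ : IsHighestWeightBasis h e σ ℓ)
    (hℓt : IsHighestWeightFrame t deg h σ V ℓt) (hx : negCoord deg x ∈ V) (s : κ) :
    MvPolynomial.eval (nonnegCoord t deg (ψ.symm (total t x))) (W s).1 =
      ∑ r, M s r * wTilde t deg ℓt r x := by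
  obtain ⟨e', htriple', hbasis⟩ := hℓt.basis _ hx
  obtain ⟨p, hp, -⟩ := hG.existsUnique_highestWeightForm htriple' hbasis
  have hex : ∃ w : κ → ℝ, ∃ y ∈ gPlus t deg, IsHighestWeightForm t deg ℓt x y w :=
    ⟨p.2, (p.1 : g), p.1.2, hp⟩
  obtain ⟨y, hy, hw⟩ := exists_isHighestWeightForm_wTilde hex
  rw [IsHighestWeightForm] at hw
  rw [hG.gPlus_eq] at hy
  refine hW.eval_eq_of_expAd_eq hG htriple hℓ (hψ.component_neg_one_symm hG rfl)
    (hψ.symm_mem_degSpace hy) (w := fun s => ∑ r, M s r * wTilde t deg ℓt r x) ?_ s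
  rw [← hψ.symm_expAd hG hy, hw, map_add, ← hψ.map_f, LieEquiv.symm_apply_apply]
  simp only [map_sum, map_smul, hψ.symm_eq_sum, Finset.smul_sum, Finset.sum_smul, smul_smul,
    mul_comm]
  rw [Finset.sum_comm]

lemma isTransport (hψ : IsTransition B t deg h f ℓ ℓt c ψ (F c))
    (hW : IsGaugeGenerators t deg f ℓ W) (hG : IsShortGrading h t deg)
    (htriple : IsSl2Triple h e f) (hℓ : IsHighestWeightBasis h e σ ℓ)
    (hℓt : IsHighestWeightFrame t deg h σ V ℓt) (hc : c ∈ V) :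
    IsTransport B t deg h W (renormalized t deg ℓt F) c ψ where
  toIsGradedConj := hψ.toIsGradedConj
  eq_eval := by
    rintro x rfl s
    exact (hψ.eval_eq_sum hW hG htriple hℓ hℓt hc s).symm

end IsTransition

theorem exists_contDiffAt_isTransition (hG : IsShortGrading h t deg) (hB : B.lieInvariant g)
    (htriple : IsSl2Triple h e f) (hℓ : IsHighestWeightBasis h e σ ℓ) (hV : IsOpen V)
    (hreg : V ⊆ regularSet B t deg h f) (hℓt : IsHighestWeightFrame t deg h σ V ℓt) (hc : c ∈ V) :
    ∃ (ψ : (NegIdx deg → ℝ) → g ≃ₗ⁅ℝ⁆ g) (F : (NegIdx deg → ℝ) → Matrix κ κ ℝ), ∀ᶠ c' in 𝓝 c,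
      IsTransition B t deg h f ℓ ℓt c' (ψ c') (F c') ∧
        ContDiffAt ℝ ∞ (fun c => coordMap t ((ψ c).symm : g →ₗ⁅ℝ⁆ g)) c' ∧
        ∀ s r, ContDiffAt ℝ ∞ (fun c => F c s r) c' := by
  obtain ⟨ψ, hψ⟩ := exists_contDiffAt_isGradedConj hG hB htriple (hreg hc)
  obtain ⟨L, hL⟩ := exists_linearMap_sum_smul_eq hℓ.linearIndependent
  refine ⟨ψ, fun c => Matrix.of fun s r => L ((ψ c).symm (ℓt r c)) s, ?_⟩
  filter_upwards [hψ, hV.mem_nhds hc] with c' ⟨hconj, hsmooth⟩ hc'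
  refine ⟨⟨hconj, fun r => (hL _ (hconj.symm_mem_span hG htriple hℓ hℓt hc' r)).symm⟩, hsmooth,
    fun s r => ?_⟩
  let L' : (ι → ℝ) →L[ℝ] ℝ := LinearMap.toContinuousLinearMap
    (LinearMap.proj s ∘ₗ L ∘ₗ t.equivFun.symm.toLinearMap)
  refine (L'.contDiff.contDiffAt.comp c' (hsmooth.clm_apply
    ((hℓt.smooth r).contDiffAt (hV.mem_nhds hc')))).congr_of_eventuallyEq (.of_forall fun c => ?_)
  simp [L', coordMap_apply]

end Transition

section RenormalizedGenerators

open Topology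

variable {g ι κ : Type*} [LieRing g] [LieAlgebra ℝ g] [Fintype ι] [Fintype κ]
  {B : LinearMap.BilinForm ℝ g} {t : Module.Basis ι ℝ g} {deg : ι → ℤ} {h e f : g}
  {U V : Set (NegIdx deg → ℝ)} {x : ι → ℝ} {ψ : g ≃ₗ⁅ℝ⁆ g} {σ : κ → ℤ}
  {ℓ : κ → g} {ℓt : κ → (NegIdx deg → ℝ) → g} {W : κ → wAlgebra t deg f} {M : Matrix κ κ ℝ}
  {F : (NegIdx deg → ℝ) → Matrix κ κ ℝ}

lemma contDiff_negCoord : ContDiff ℝ ∞ (negCoord deg) :=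
  contDiff_pi.2 fun α => contDiff_apply ℝ ℝ (α : ι)

omit [Fintype κ] in
lemma IsHighestWeightFrame.linearIndependent {c : NegIdx deg → ℝ}
    (hℓt : IsHighestWeightFrame t deg h σ V ℓt)
    (hc : c ∈ V) : LinearIndependent ℝ fun s => ℓt s c := by
  obtain ⟨e', -, hbasis⟩ := hℓt.basis c hc
  exact hbasis.linearIndependent

lemma IsTransition.wTilde_eq_sum [DecidableEq κ]
    (hψ : IsTransition B t deg h f ℓ ℓt (negCoord deg x) ψ M)
    (hW : IsGaugeGenerators t deg f ℓ W) (hG : IsShortGrading h t deg)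
    (htriple : IsSl2Triple h e f) (hℓ : IsHighestWeightBasis h e σ ℓ)
    (hℓt : IsHighestWeightFrame t deg h σ V ℓt) (hx : negCoord deg x ∈ V) (s : κ) :
    wTilde t deg ℓt s x = ∑ r, M⁻¹ s r *
      nonnegEval (W r).1 (coordMap t (ψ.symm : g →ₗ⁅ℝ⁆ g) x) := by
  have hmulVec : (fun r => nonnegEval (W r).1 (coordMap t (ψ.symm : g →ₗ⁅ℝ⁆ g) x)) =
      M.mulVec fun r => wTilde t deg ℓt r x := by
    funext r
    refine Eq.trans ?_ (hψ.eval_eq_sum hW hG htriple hℓ hℓt hx r)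
    rw [total_eq_equivFun_symm]
    rfl
  have hdet := (Matrix.isUnit_iff_isUnit_det _).1 (hψ.isUnit (hℓt.linearIndependent hx))
  change _ = (M⁻¹.mulVec fun r => nonnegEval (W r).1 (coordMap t (ψ.symm : g →ₗ⁅ℝ⁆ g) x)) s
  rw [hmulVec, Matrix.mulVec_mulVec, Matrix.nonsing_inv_mul _ hdet, Matrix.one_mulVec]

lemma contDiffAt_wTilde (hW : IsGaugeGenerators t deg f ℓ W) (hG : IsShortGrading h t deg)
    (hB : B.lieInvariant g) (htriple : IsSl2Triple h e f) (hℓ : IsHighestWeightBasis h e σ ℓ)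
    (hV : IsOpen V) (hreg : V ⊆ regularSet B t deg h f)
    (hℓt : IsHighestWeightFrame t deg h σ V ℓt) (hx : negCoord deg x ∈ V) (s : κ) :
    ContDiffAt ℝ ∞ (wTilde t deg ℓt s) x := by
  classical
  obtain ⟨ψ, F, hψF⟩ := exists_contDiffAt_isTransition hG hB htriple hℓ hV hreg hℓt hx
  obtain ⟨hψ, hψ_smooth, hF_smooth⟩ := hψF.self_of_nhds
  have hneg : ContDiffAt ℝ ∞ (negCoord deg) x := contDiff_negCoord.contDiffAt
  have hinv (r : κ) : ContDiffAt ℝ ∞ (fun z => (F (negCoord deg z))⁻¹ s r) x :=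
    contDiffAt_matrix_inv (fun s r => (hF_smooth s r).comp x hneg)
      (hψ.isUnit (hℓt.linearIndependent hx)) s r
  have heval (r : κ) : ContDiffAt ℝ ∞ (fun z => nonnegEval (W r).1
      (coordMap t ((ψ (negCoord deg z)).symm : g →ₗ⁅ℝ⁆ g) z)) x :=
    (contDiff_nonnegEval _).contDiffAt.comp x ((hψ_smooth.comp x hneg).clm_apply contDiffAt_id)
  refine (ContDiffAt.sum (s := Finset.univ) fun r _ =>
    (hinv r).mul (heval r)).congr_of_eventuallyEq ?_
  filter_upwards [hneg.continuousAt.eventually hψF,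
    hneg.continuousAt.preimage_mem_nhds (hV.mem_nhds hx)] with z hz hzV
  exact hz.1.wTilde_eq_sum hW hG htriple hℓ hℓt hzV s

theorem formWAlgebra_renormalized [DecidableEq ι] (hG : IsShortGrading h t deg)
    (hB : B.lieInvariant g) (hsymm : B.IsSymm) (hnd : B.Nondegenerate)
    (htriple : IsSl2Triple h e f) (hℓ : IsHighestWeightBasis h e σ ℓ)
    (hW : IsGaugeGenerators t deg f ℓ W) (hV : IsOpen V) (hreg : V ⊆ regularSet B t deg h f)
    (hℓt : IsHighestWeightFrame t deg h σ V ℓt) (hUV : U ⊆ V) (hne : U.Nonempty)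
    (hF : ∀ c ∈ U, ∀ s r, ContDiffAt ℝ ∞ (fun c => F c s r) c)
    (hψ : ∀ c ∈ U, ∃ ψ, IsTransition B t deg h f ℓ ℓt c ψ (F c)) :
    FormWAlgebra B t deg f U W (renormalized t deg ℓt F) := by
  refine formWAlgebra_of_isTransport hG hB hsymm hnd htriple hℓ hW hne (fun s x hx => ?_)
    fun c hc => ?_
  · exact ContDiffAt.sum fun r _ => ((hF _ hx s r).comp x contDiff_negCoord.contDiffAt).mul
      (contDiffAt_wTilde hW hG hB htriple hℓ hV hreg hℓt (hUV hx) r)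
  · obtain ⟨ψ, hψc⟩ := hψ c hc
    exact ⟨ψ, hψc.isTransport hW hG htriple hℓ hℓt (hUV hc)⟩

end RenormalizedGenerators

section Gluing

open Topology

variable {E Y : Type*} [TopologicalSpace E] {V : Set E}

lemma exists_pairwiseDisjoint_subset_closure_sUnion {𝒩 : Set (Set E)}
    (h𝒩 : ∀ T, IsOpen T → (T ∩ V).Nonempty → ∃ N ∈ 𝒩, N.Nonempty ∧ N ⊆ T) {N₀ : Set E}
    (hN₀ : N₀ ∈ 𝒩) :
    ∃ S ⊆ 𝒩, N₀ ∈ S ∧ S.PairwiseDisjoint id ∧ V ⊆ closure (⋃₀ S) := by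
  obtain ⟨S, hN₀S, ⟨hS𝒩, hS⟩, hmax⟩ := zorn_subset_nonempty
    {S : Set (Set E) | S ⊆ 𝒩 ∧ S.PairwiseDisjoint id}
    (fun C hC hchain _ => ⟨⋃₀ C, ⟨Set.sUnion_subset fun S hS => (hC hS).1,
      (Set.pairwise_sUnion hchain.directedOn).2 fun S hS => (hC hS).2⟩,
      fun S hS => Set.subset_sUnion_of_mem hS⟩)
    {N₀} ⟨Set.singleton_subset_iff.2 hN₀, Set.pairwiseDisjoint_singleton _ _⟩
  refine ⟨S, hS𝒩, Set.singleton_subset_iff.1 hN₀S, hS, fun c hc => by_contra fun hcS => ?_⟩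
  obtain ⟨N, hN, ⟨b, hb⟩, hNS⟩ := h𝒩 _ isClosed_closure.isOpen_compl ⟨c, hcS, hc⟩
  have hdisj : Disjoint N (⋃₀ S) :=
    Set.disjoint_left.2 fun a ha haS => hNS ha (subset_closure haS)
  have hinsert : insert N S ⊆ S := hmax ⟨Set.insert_subset hN hS𝒩, hS.insert fun M hM _ =>
    hdisj.mono_right (Set.subset_sUnion_of_mem hM)⟩ (Set.subset_insert N S)
  exact hdisj.ne_of_mem hb ⟨N, hinsert (Set.mem_insert N S), hb⟩ rfl

/-- `Q F c` is a property of the germ of `F` at `c`. -/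
def IsGermProperty (Q : (E → Y) → E → Prop) : Prop :=
  ∀ ⦃F F' : E → Y⦄ ⦃c : E⦄, F' =ᶠ[𝓝 c] F → Q F c → Q F' c

variable [Nonempty Y] {Q : (E → Y) → E → Prop}

lemma IsGermProperty.exists_forall_sUnion (hQ : IsGermProperty Q) {S : Set (Set E)}
    (hopen : ∀ N ∈ S, IsOpen N) (hS : S.PairwiseDisjoint id)
    (hF : ∀ N ∈ S, ∃ F, ∀ c ∈ N, Q F c) : ∃ F, ∀ c ∈ ⋃₀ S, Q F c := by
  choose! F hF using hF
  choose! N hNS hcN using fun c (hc : c ∈ ⋃₀ S) => hc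
  refine ⟨fun c => F (N c) c, fun c hc => hQ ?_ (hF _ (hNS c hc) c (hcN c hc))⟩
  filter_upwards [(hopen _ (hNS c hc)).mem_nhds (hcN c hc)] with c' hc'
  have hc'S : c' ∈ ⋃₀ S := ⟨N c, hNS c hc, hc'⟩
  rw [hS.elim_set (hNS c' hc'S) (hNS c hc) c' (hcN c' hc'S) hc']

theorem IsGermProperty.exists_dense_open (hQ : IsGermProperty Q) (hV : IsOpen V)
    (hloc : ∀ c ∈ V, ∃ F, ∀ᶠ c' in 𝓝 c, Q F c') {c₀ : E} (hc₀ : c₀ ∈ V) :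
    ∃ U, IsOpen U ∧ c₀ ∈ U ∧ U ⊆ V ∧ V ⊆ closure U ∧ ∃ F, ∀ c ∈ U, Q F c := by
  let 𝒩 : Set (Set E) := {N | IsOpen N ∧ N ⊆ V ∧ ∃ F, ∀ c ∈ N, Q F c}
  have h𝒩 (T : Set E) (hT : IsOpen T) {c : E} (hcT : c ∈ T) (hc : c ∈ V) :
      ∃ N ∈ 𝒩, c ∈ N ∧ N ⊆ T := by
    obtain ⟨F, hF⟩ := hloc c hc
    obtain ⟨N, hNF, hN, hcN⟩ := eventually_nhds_iff.1 hF
    exact ⟨N ∩ (V ∩ T), ⟨hN.inter (hV.inter hT), fun a ha => ha.2.1, F, fun a ha => hNF a ha.1⟩,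
      ⟨hcN, hc, hcT⟩, fun a ha => ha.2.2⟩
  obtain ⟨N₀, hN₀, hc₀N₀, -⟩ := h𝒩 Set.univ isOpen_univ (Set.mem_univ c₀) hc₀
  obtain ⟨S, hS𝒩, hN₀S, hS, hdense⟩ := exists_pairwiseDisjoint_subset_closure_sUnion
    (fun T hT hTV => by
      obtain ⟨c, hcT, hc⟩ := hTV
      obtain ⟨N, hN, hcN, hNT⟩ := h𝒩 T hT hcT hc
      exact ⟨N, hN, ⟨c, hcN⟩, hNT⟩) hN₀
  exact ⟨⋃₀ S, isOpen_sUnion fun N hN => (hS𝒩 hN).1, ⟨N₀, hN₀S, hc₀N₀⟩,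
    Set.sUnion_subset fun N hN => (hS𝒩 hN).2.1, hdense,
    hQ.exists_forall_sUnion (fun N hN => (hS𝒩 hN).1) hS fun N hN => (hS𝒩 hN).2.2⟩

end Gluing

section Renormalization

open Topology

variable {g ι κ : Type*} [LieRing g] [LieAlgebra ℝ g] [Fintype ι] [DecidableEq ι] [Fintype κ]
  [DecidableEq κ] {B : LinearMap.BilinForm ℝ g} {t : Module.Basis ι ℝ g} {deg : ι → ℤ} {h e f : g}
  {V : Set (NegIdx deg → ℝ)} {σ : κ → ℤ} {ℓ : κ → g} {ℓt : κ → (NegIdx deg → ℝ) → g}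
  {W : κ → wAlgebra t deg f}

theorem exists_dense_formWAlgebra_renormalized (hG : IsShortGrading h t deg)
    (hB : B.lieInvariant g) (hsymm : B.IsSymm) (hnd : B.Nondegenerate)
    (htriple : IsSl2Triple h e f) (hℓ : IsHighestWeightBasis h e σ ℓ)
    (hW : IsGaugeGenerators t deg f ℓ W) (hV : IsOpen V) (hreg : V ⊆ regularSet B t deg h f)
    (hℓt : IsHighestWeightFrame t deg h σ V ℓt) {c₀ : NegIdx deg → ℝ} (hc₀ : c₀ ∈ V) :
    ∃ U, IsOpen U ∧ c₀ ∈ U ∧ U ⊆ V ∧ V ⊆ closure U ∧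
      ∃ F : (NegIdx deg → ℝ) → Matrix κ κ ℝ,
        (∀ s r, ContDiffOn ℝ ∞ (fun c => F c s r) U) ∧
        (∀ c ∈ U, IsUnit (F c)) ∧
        (∀ c ∈ U, ∀ s r, σ s ≠ σ r → F c s r = 0) ∧
        FormWAlgebra B t deg f U W (renormalized t deg ℓt F) := by
  let Q (F : (NegIdx deg → ℝ) → Matrix κ κ ℝ) (c : NegIdx deg → ℝ) : Prop :=
    (∃ ψ, IsTransition B t deg h f ℓ ℓt c ψ (F c)) ∧ ∀ s r, ContDiffAt ℝ ∞ (fun c => F c s r) c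
  have hQ : IsGermProperty Q := fun F F' c heq ⟨hψ, hF⟩ =>
    ⟨heq.self_of_nhds ▸ hψ, fun s r =>
      (hF s r).congr_of_eventuallyEq (heq.fun_comp fun M : Matrix κ κ ℝ => M s r)⟩
  have hlocal (c) (hc : c ∈ V) : ∃ F, ∀ᶠ c' in 𝓝 c, Q F c' := by
    obtain ⟨ψ, F, hψF⟩ := exists_contDiffAt_isTransition hG hB htriple hℓ hV hreg hℓt hc
    exact ⟨F, hψF.mono fun c' hc' => ⟨⟨ψ c', hc'.1⟩, hc'.2.2⟩⟩
  obtain ⟨U, hU, hc₀U, hUV, hVU, F, hF⟩ := hQ.exists_dense_open hV hlocal hc₀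
  refine ⟨U, hU, hc₀U, hUV, hVU, F, fun s r c hc => ((hF c hc).2 s r).contDiffWithinAt,
    fun c hc => ?_, fun c hc s r hsr => ?_,
    formWAlgebra_renormalized hG hB hsymm hnd htriple hℓ hW hV hreg hℓt hUV ⟨c₀, hc₀U⟩
      (fun c hc => (hF c hc).2) fun c hc => (hF c hc).1⟩
  · obtain ⟨ψ, hψ⟩ := (hF c hc).1
    exact hψ.isUnit (hℓt.linearIndependent (hUV hc))
  · obtain ⟨ψ, hψ⟩ := (hF c hc).1
    obtain ⟨e', -, hbasis⟩ := hℓt.basis c (hUV hc)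
    exact hψ.apply_eq_zero hℓ hbasis.weight hsr

omit [DecidableEq ι] in
lemma IsGradedConj.isTransition_diagonal {c : NegIdx deg → ℝ} {ψ : g ≃ₗ⁅ℝ⁆ g}
    (hψ : IsGradedConj B t deg h f c ψ) {m : κ → ℝ} (hm : ∀ s, m s ≠ 0)
    (hℓψ : ∀ s, ψ (ℓ s) = m s • ℓt s c) :
    IsTransition B t deg h f ℓ ℓt c ψ (Matrix.diagonal fun s => (m s)⁻¹) where
  toIsGradedConj := hψ
  symm_eq_sum r := by
    have hsymm : ψ.symm (ℓt r c) = (m r)⁻¹ • ℓ r := by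
      rw [← ψ.symm_apply_apply (ℓ r), hℓψ, map_smul, inv_smul_smul₀ (hm r)]
    simp [hsymm, Matrix.diagonal_apply]

omit [DecidableEq κ] in
theorem formWAlgebra_of_proportional (hG : IsShortGrading h t deg)
    (hB : B.lieInvariant g) (hsymm : B.IsSymm) (hnd : B.Nondegenerate)
    (htriple : IsSl2Triple h e f) (hℓ : IsHighestWeightBasis h e σ ℓ)
    (hW : IsGaugeGenerators t deg f ℓ W) (hV : IsOpen V)
    (hℓt : IsHighestWeightFrame t deg h σ V ℓt) (hne : V.Nonempty)
    {m : κ → (NegIdx deg → ℝ) → ℝ} (hm : ∀ s, ContDiffOn ℝ ∞ (m s) V)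
    (hm0 : ∀ s, ∀ c ∈ V, m s c ≠ 0)
    (hψ : ∀ c ∈ V, ∃ ψ : g ≃ₗ⁅ℝ⁆ g, IsGradedConj B t deg h f c ψ ∧
      ∀ s, ψ (ℓ s) = m s c • ℓt s c) :
    FormWAlgebra B t deg f V W
      fun s x => (m s (negCoord deg x))⁻¹ * wTilde t deg ℓt s x := by
  classical
  have heq : (fun s x => (m s (negCoord deg x))⁻¹ * wTilde t deg ℓt s x) =
      renormalized t deg ℓt fun c => Matrix.diagonal fun s => (m s c)⁻¹ := by
    funext s x
    simp [renormalized, Matrix.diagonal_apply]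
  rw [heq]
  refine formWAlgebra_renormalized hG hB hsymm hnd htriple hℓ hW hV
    (fun c hc => (hψ c hc).imp fun _ hconj => hconj.1) hℓt subset_rfl hne
    (fun c hc s r => ?_) fun c hc => ?_
  · simp only [Matrix.diagonal_apply]
    split_ifs
    exacts [((hm s).contDiffAt (hV.mem_nhds hc)).inv (hm0 s c hc), contDiffAt_const]
  · obtain ⟨ψ, hconj, hψℓ⟩ := hψ c hc
    exact ⟨ψ, hconj.isTransition_diagonal (fun s => hm0 s c hc) hψℓ⟩

end Renormalization

end FiniteW

theorem mainTheorem3_general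
    {g : Type*} [LieRing g] [LieAlgebra ℝ g]
    {B : LinearMap.BilinForm ℝ g} (hB : B.lieInvariant g) (hsymm : B.IsSymm)
    (hnd : B.Nondegenerate)
    {h e f : g} (htriple : IsSl2Triple h e f)
    {ι : Type*} [Fintype ι] [DecidableEq ι]
    (t : Module.Basis ι ℝ g) (deg : ι → ℤ)
    (hdeg : ∀ a, ⁅h, t a⁆ = (2 * (deg a : ℝ)) • t a)
    (habel : ∀ x ∈ FiniteW.gPlus t deg, ∀ y ∈ FiniteW.gPlus t deg, ⁅x, y⁆ = 0)
    {κ : Type*} [Fintype κ] [DecidableEq κ] (σ : κ → ℤ)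
    (ℓ : κ → g) (hℓ : FiniteW.IsHighestWeightBasis h e σ ℓ)
    (V : Set (FiniteW.NegIdx deg → ℝ)) (hVopen : IsOpen V)
    (hV : V ⊆ FiniteW.regularSet B t deg h f)
    (ℓt : κ → (FiniteW.NegIdx deg → ℝ) → g)
    (hℓt : FiniteW.IsHighestWeightFrame t deg h σ V ℓt) :
    (∀ x, FiniteW.negCoord deg x ∈ V →
      ∃! p : FiniteW.gPlus t deg × (κ → ℝ),
        FiniteW.IsHighestWeightForm t deg ℓt x (p.1 : g) p.2) ∧
    (∀ p q : FiniteW.wAlgebra t deg f,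
      FiniteW.constrBracket B t deg f p q ∈
        FiniteW.wAlgebra t deg f) ∧
    ∃ W : κ → FiniteW.wAlgebra t deg f,
      FiniteW.IsGaugeGenerators t deg f ℓ W ∧
      Algebra.adjoin ℝ (Set.range W) = ⊤ ∧
      (∀ c₀ ∈ V, ∃ U : Set (FiniteW.NegIdx deg → ℝ),
        IsOpen U ∧ c₀ ∈ U ∧ U ⊆ V ∧ V ⊆ closure U ∧
        ∃ F : (FiniteW.NegIdx deg → ℝ) → Matrix κ κ ℝ,
          (∀ s r, ContDiffOn ℝ ∞ (fun c => F c s r) U) ∧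
          (∀ c ∈ U, IsUnit (F c)) ∧
          (∀ c ∈ U, ∀ s r, σ s ≠ σ r → F c s r = 0) ∧
          FiniteW.FormWAlgebra B t deg f U W
            (FiniteW.renormalized t deg ℓt F)) ∧
      (V.Nonempty → ∀ m : κ → (FiniteW.NegIdx deg → ℝ) → ℝ,
        (∀ s, ContDiffOn ℝ ∞ (m s) V) → (∀ s, ∀ c ∈ V, m s c ≠ 0) →
        (∀ c ∈ V, ∃ ψ : g ≃ₗ⁅ℝ⁆ g,
          FiniteW.IsGradedConj B t deg h f c ψ ∧
          ∀ s, ψ (ℓ s) = m s c • ℓt s c) →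
        FiniteW.FormWAlgebra B t deg f V W
          (fun s x => (m s (FiniteW.negCoord deg x))⁻¹ * FiniteW.wTilde t deg ℓt s x)) := by
  have hf := FiniteW.f_mem_degSpace (𝕜 := ℝ) htriple
  have hG := FiniteW.isShortGrading_of_abelian hB hnd.1 htriple
    (fun a => FiniteW.mem_degSpace.2 (hdeg a)) habel
  obtain ⟨W, hW⟩ := hG.exists_isGaugeGenerators htriple hℓ
  refine ⟨fun x hx => ?_, hG.constrBracket_mem hB hsymm hnd hf, W, hW, hW.adjoin_eq_top hG hf,
    fun c₀ hc₀ => ?_, fun hne m hm hm0 hψ => ?_⟩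
  · obtain ⟨e', htriple', hbasis⟩ := hℓt.basis _ hx
    exact hG.existsUnique_highestWeightForm htriple' hbasis
  · exact FiniteW.exists_dense_formWAlgebra_renormalized hG hB hsymm hnd htriple hℓ hW hVopen hV
      hℓt hc₀
  · exact FiniteW.formWAlgebra_of_proportional hG hB hsymm hnd htriple hℓ hW hVopen hℓt hne hm
      hm0 hψ

theorem mainTheorem3
    {g : Type*} [LieRing g] [LieAlgebra ℝ g] [LieAlgebra.IsSimple ℝ g]
    {R : Type*} [AddCommGroup R] [Module ℝ R] [FiniteDimensional ℝ R]
    [LieRingModule g R] [LieModule ℝ g R]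
    (hR : (LieModule.traceForm ℝ g R).Nondegenerate)
    {h e f : g} (htriple : IsSl2Triple h e f)
    {ι : Type*} [Fintype ι] [DecidableEq ι]
    (t : Module.Basis ι ℝ g) (deg : ι → ℤ)
    (hdeg : ∀ a, ⁅h, t a⁆ = (2 * (deg a : ℝ)) • t a)
    (habel : ∀ x ∈ FiniteW.gPlus t deg, ∀ y ∈ FiniteW.gPlus t deg, ⁅x, y⁆ = 0)
    {κ : Type*} [Fintype κ] [DecidableEq κ] (σ : κ → ℤ)
    (ℓ : κ → g) (hℓ : FiniteW.IsHighestWeightBasis h e σ ℓ)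
    (V : Set (FiniteW.NegIdx deg → ℝ)) (hVopen : IsOpen V)
    (hV : V ⊆ FiniteW.regularSet (LieModule.traceForm ℝ g R) t deg h f)
    (ℓt : κ → (FiniteW.NegIdx deg → ℝ) → g)
    (hℓt : FiniteW.IsHighestWeightFrame t deg h σ V ℓt) :
    -- over `V` the highest weight form is reached by a unique element of `G_+`
    (∀ x, FiniteW.negCoord deg x ∈ V →
      ∃! p : FiniteW.gPlus t deg × (κ → ℝ),
        FiniteW.IsHighestWeightForm t deg ℓt x (p.1 : g) p.2) ∧
    -- the finite W-algebra is closed under its bracket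
    (∀ p q : FiniteW.wAlgebra t deg f,
      FiniteW.constrBracket (LieModule.traceForm ℝ g R) t deg f p q ∈
        FiniteW.wAlgebra t deg f) ∧
    -- it is generated by the `W_s`
    ∃ W : κ → FiniteW.wAlgebra t deg f,
      FiniteW.IsGaugeGenerators t deg f ℓ W ∧
      Algebra.adjoin ℝ (Set.range W) = ⊤ ∧
      -- the renormalization, for an arbitrary choice of the highest weight vectors
      (∀ c₀ ∈ V, ∃ U : Set (FiniteW.NegIdx deg → ℝ),
        IsOpen U ∧ c₀ ∈ U ∧ U ⊆ V ∧ V ⊆ closure U ∧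
        ∃ F : (FiniteW.NegIdx deg → ℝ) → Matrix κ κ ℝ,
          (∀ s r, ContDiffOn ℝ ∞ (fun c => F c s r) U) ∧
          (∀ c ∈ U, IsUnit (F c)) ∧
          (∀ c ∈ U, ∀ s r, σ s ≠ σ r → F c s r = 0) ∧
          FiniteW.FormWAlgebra (LieModule.traceForm ℝ g R) t deg f U W
            (FiniteW.renormalized t deg ℓt F)) ∧
      -- the renormalization generator by generator, for highest weight vectors proportional to
      -- conjugates of the `ℓ^s`
      (V.Nonempty → ∀ m : κ → (FiniteW.NegIdx deg → ℝ) → ℝ,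
        (∀ s, ContDiffOn ℝ ∞ (m s) V) → (∀ s, ∀ c ∈ V, m s c ≠ 0) →
        (∀ c ∈ V, ∃ ψ : g ≃ₗ⁅ℝ⁆ g,
          FiniteW.IsGradedConj (LieModule.traceForm ℝ g R) t deg h f c ψ ∧
          ∀ s, ψ (ℓ s) = m s c • ℓt s c) →
        FiniteW.FormWAlgebra (LieModule.traceForm ℝ g R) t deg f V W
          (fun s x => (m s (FiniteW.negCoord deg x))⁻¹ * FiniteW.wTilde t deg ℓt s x)) := by
  exact mainTheorem3_general (LieModule.traceForm_lieInvariant ℝ g R)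
    ⟨LieModule.traceForm_comm ℝ g R⟩ hR htriple t deg hdeg habel σ ℓ hℓ V hVopen hV ℓt hℓt
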